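/- Let $\mathbb K$ be a commutative ring. For a $\mathbb K$-module $V$ let $\mathscr F(V)=\bigoplus_{n\ge0}\mathscr F_n(V)$ with $\mathscr F_n(V)=V^{\otimes n}\#\mathbb K\mathfrak S_n$, the tensor product of $V^{\otimes n}$ and $\mathbb K\mathfrak S_n$ (with pure tensors written $t\#\sigma$), and let $\mathfrak S_n$ act on the left on $\mathscr F_n(V)$ by $\pi\cdot[(v_1\otimes\cdots\otimes v_n)\#\sigma]=(v_{\pi^{-1}(1)}\otimes\cdots\otimes v_{\pi^{-1}(n)})\#\pi\sigma$. The external product on $\mathscr F(V)$ is the bilinear product with $$(t\#\sigma)*(t'\#\sigma')=\sum_{\pi}\pi\cdot\bigl[(t\otimes t')\#(\sigma\times\sigma')\bigr]\qquad(t\in V^{\otimes n},\ \sigma\in\mathfrak S_n,\ t'\in V^{\otimes m},\ \sigma'\in\mathfrak S_m),$$ where $\pi$ runs over the permutations in $\mathfrak S_{n+m}$ that are increasing on $\{1,\dots,n\}$ and on $\{n+1,\dots,n+m\}$; its unit is $()\#e_0$. For a graded submodule $W=\bigoplus_n W_n$ of the tensor algebra $\mathrm T(V)=\bigoplus_nV^{\otimes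 n}$, the descent algebra $\Sigma(W)$ is the (unital) subalgebra of $(\mathscr F(V),*)$ generated by the elements $t\#e_n$ with $n\ge0$ and $t\in W_n$, where $e_n\in\mathfrak S_n$ is the identity. Let $\mathrm{TS}^n(V)\subseteq V^{\otimes n}$ be the module of symmetric tensors, and let $\mathrm{NT}(V)=\Sigma\bigl(\bigoplus_n\mathrm{TS}^n(V)\bigr)$. If $V$ is a coalgebra with iterated coproducts $\delta_n:V\to V^{\otimes n}$ ($\delta_0$ is the counit, $\delta_1=\mathrm{id}$), let $\mathrm{MR}(V)=\Sigma\bigl(\bigoplus_n\delta_n(V)\bigr)$. Let $A$ be an (associative, unital) $\mathbb K$-algebra whose underlying $\mathbb K$-module is projective. Then $\mathscr F_n(A)$ is the twisted group ring of $\mathfrak S_n$ over $A^{\otimes n}$, with the internal product $$[(a_1\otimes\cdots\otimes a_n)\#\sigma]\cdot[(b_1\otimes\cdots\otimes b_n)\#\tau]=(a_1b_{\sigma^{-1}(1)}\otimes\cdots\otimes a_nb_{\sigma^{-1}(n)})\#\sigma\tau$$ and the unit $1^{\otimes n}\#e_n$. A graded submodule $S$ of $\mathscr F(A)$ is called a subalgebra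 for the internal product if, for each $n$, $S\cap\mathscr F_n(A)$ is closed under the internal product of $\mathscr F_n(A)$. Let $B=\bigoplus_nB_n$ be a graded submodule of $\mathrm T(A)$ such that - (A) for each positive integer $n$ and each finite sequence $(c_1,\dots,c_k)$ of non-negative integers with sum $n$, $B_n$ is contained in the image of $B_{c_1}\otimes\cdots\otimes B_{c_k}$ in $A^{\otimes n}$; - (B) each $B_n$ is closed under the multiplication of $A^{\otimes n}$; - (C) $B_n\subseteq\mathrm{TS}^n(A)$ for each $n$. Then $\Sigma(B)$ is a subalgebra of $\mathscr F(A)$ for the internal product; moreover, for each $n$ such that $1^{\otimes n}\in B_n$, it contains the unit $1^{\otimes n}\#e_n$ of $\mathscr F_n(A)$. In particular, $\mathrm{NT}(A)$ is a subalgebra of $\mathscr F(A)$ for the internal product, and so is $\mathrm{MR}(A)$ when $A$ is moreover a cocommutative bialgebra; both contain the units $1^{\otimes n}\#e_n$ for all $n$. -/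

import Mathlib

open scoped TensorProduct DirectSum

noncomputable section

namespace FreeQSym

universe u v

section Module

variable (K : Type u) [CommRing K] (V : Type v) [AddCommGroup V] [Module K V]

/-- The left action of `𝔖ₙ` on `V^{⊗n}` by permutation of the factors,
`π • (v₁ ⊗ ⋯ ⊗ vₙ) = v_{π⁻¹(1)} ⊗ ⋯ ⊗ v_{π⁻¹(n)}`. -/
instance permAction (n : ℕ) : DistribMulAction (Equiv.Perm (Fin n)) (⨂[K]^n V) where
  smul π t := PiTensorProduct.reindex K (fun _ => V) π t
  one_smul t := by
    change PiTensorProduct.reindex K (fun _ => V) (Equiv.refl (Fin n)) t = t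
    rw [PiTensorProduct.reindex_refl]; rfl
  mul_smul π ρ t := (PiTensorProduct.reindex_reindex (R := K) (s := fun _ => V) ρ π t).symm
  smul_zero π := map_zero (PiTensorProduct.reindex K (fun _ => V) π)
  smul_add π := map_add (PiTensorProduct.reindex K (fun _ => V) π)

variable {K V}

theorem perm_smul_tprod {n : ℕ} (π : Equiv.Perm (Fin n)) (a : Fin n → V) :
    π • PiTensorProduct.tprod K a = PiTensorProduct.tprod K (fun i => a (π⁻¹ i)) :=
  PiTensorProduct.reindex_tprod (R := K) (s := fun _ => V) π a

variable (K V)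

/-- The action of a permutation on `V^{⊗n}`, as a linear map. -/
def permLin {n : ℕ} (π : Equiv.Perm (Fin n)) : ⨂[K]^n V →ₗ[K] ⨂[K]^n V :=
  (PiTensorProduct.reindex K (fun _ => V) π).toLinearMap

/-- The homogeneous component `𝓕ₙ(V) = V^{⊗n} # K𝔖ₙ`: formal sums of symbols `t # σ`, where
`t ∈ V^{⊗n}` and `σ ∈ 𝔖ₙ`. The symbol `t # σ` is `SkewMonoidAlgebra.single σ t`. When `V` is an
algebra, the multiplication of this type is that of the twisted group ring, i.e. the internal
product. -/
abbrev FComp (n : ℕ) : Type (max u v) := SkewMonoidAlgebra (⨂[K]^n V) (Equiv.Perm (Fin n))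

/-- The module `𝓕(V) = ⨁ₙ 𝓕ₙ(V)`. -/
abbrev F : Type (max u v) := ⨁ n : ℕ, FComp K V n

/-- The linear map `t ↦ t # σ`. -/
def sharp {n : ℕ} (σ : Equiv.Perm (Fin n)) : ⨂[K]^n V →ₗ[K] FComp K V n :=
  (SkewMonoidAlgebra.coeffLinearEquiv (S := K)).symm.toLinearMap ∘ₗ Finsupp.lsingle σ

variable {K V} in
theorem sharp_apply {n : ℕ} (σ : Equiv.Perm (Fin n)) (t : ⨂[K]^n V) :
    sharp K V σ t = SkewMonoidAlgebra.single σ t := rfl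

/-- The permutation `σ × σ' ∈ 𝔖ₙ × 𝔖ₘ ⊆ 𝔖ₙ₊ₘ`. -/
def permProd {n m : ℕ} (σ : Equiv.Perm (Fin n)) (σ' : Equiv.Perm (Fin m)) :
    Equiv.Perm (Fin (n + m)) :=
  finSumFinEquiv.permCongr (Equiv.Perm.sumCongr σ σ')

open Classical in
/-- The set `X_{(n,m)}` of the permutations of `n + m` letters that are increasing on the first
`n` letters and on the last `m` letters. -/
def shuffles (n m : ℕ) : Finset (Equiv.Perm (Fin (n + m))) :=
  Finset.univ.filter fun π =>
    StrictMono (fun i : Fin n => π (Fin.castAdd m i)) ∧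
      StrictMono (fun j : Fin m => π (Fin.natAdd n j))

/-- The bilinear map `(t, t') ↦ x_{(n,m)} · [(t ⊗ t') # (σ × σ')]`. -/
def extMulSharp {n m : ℕ} (σ : Equiv.Perm (Fin n)) (σ' : Equiv.Perm (Fin m)) :
    ⨂[K]^n V →ₗ[K] ⨂[K]^m V →ₗ[K] FComp K V (n + m) :=
  (TensorProduct.mk K (⨂[K]^n V) (⨂[K]^m V)).compr₂
    ((∑ π ∈ shuffles n m, sharp K V (π * permProd σ σ') ∘ₗ permLin K V π) ∘ₗ
      (TensorPower.mulEquiv (R := K) (M := V)).toLinearMap)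

/-- The external product `𝓕ₙ(V) × 𝓕ₘ(V) → 𝓕ₙ₊ₘ(V)`. -/
def extMulComp (n m : ℕ) : FComp K V n →ₗ[K] FComp K V m →ₗ[K] FComp K V (n + m) :=
  (Finsupp.lsum K fun σ =>
    ((Finsupp.lsum K fun σ' => (extMulSharp K V σ σ').flip) ∘ₗ
      (SkewMonoidAlgebra.coeffLinearEquiv (S := K)).toLinearMap).flip) ∘ₗ
    (SkewMonoidAlgebra.coeffLinearEquiv (S := K)).toLinearMap

variable {K V} in
theorem extMulComp_single_single {n m : ℕ} (σ : Equiv.Perm (Fin n)) (σ' : Equiv.Perm (Fin m))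
    (t : ⨂[K]^n V) (t' : ⨂[K]^m V) :
    extMulComp K V n m (SkewMonoidAlgebra.single σ t) (SkewMonoidAlgebra.single σ' t') =
      ∑ π ∈ shuffles n m, SkewMonoidAlgebra.single (π * permProd σ σ')
        (π • TensorPower.mulEquiv (t ⊗ₜ[K] t')) := by
  simp [extMulComp, extMulSharp, SkewMonoidAlgebra.coeffLinearEquiv, sharp_apply]
  rfl

/-- The external product `*` on `𝓕(V)`. -/
def extMul : F K V →ₗ[K] F K V →ₗ[K] F K V :=
  DirectSum.toModule K ℕ _ fun n =>
    (DirectSum.toModule K ℕ _ fun m =>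
      ((extMulComp K V n m).compr₂ (DirectSum.lof K ℕ (FComp K V) (n + m))).flip).flip

variable {K V} in
theorem extMul_lof_lof {n m : ℕ} (a : FComp K V n) (b : FComp K V m) :
    extMul K V (DirectSum.lof K ℕ (FComp K V) n a) (DirectSum.lof K ℕ (FComp K V) m b) =
      DirectSum.lof K ℕ (FComp K V) (n + m) (extMulComp K V n m a b) := by
  simp [extMul]

/-- The unit `() # e₀` of `𝓕(V)` for the external product. -/
def extOne : F K V :=
  DirectSum.lof K ℕ (FComp K V) 0
    (SkewMonoidAlgebra.single 1 (PiTensorProduct.tprod K Fin.elim0))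

variable {K V}

/-- The descent algebra `Σ(W)` of a graded submodule `W = ⨁ₙ Wₙ` of the tensor algebra, given by
its components `Wₙ ⊆ V^{⊗n}`: the subalgebra of `𝓕(V)` for the external product generated by the
elements `t # eₙ`, where `t ∈ Wₙ`. -/
def descentAlgebra (W : (n : ℕ) → Submodule K (⨂[K]^n V)) : Submodule K (F K V) :=
  sInf {S | extOne K V ∈ S ∧ (∀ x ∈ S, ∀ y ∈ S, extMul K V x y ∈ S) ∧
    ∀ n, ∀ t ∈ W n, DirectSum.lof K ℕ (FComp K V) n (SkewMonoidAlgebra.single 1 t) ∈ S}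

/-- The intersection `S ∩ 𝓕ₙ(V)`, as a submodule of `𝓕ₙ(V)`. -/
def component (S : Submodule K (F K V)) (n : ℕ) : Submodule K (FComp K V n) :=
  S.comap (DirectSum.lof K ℕ (FComp K V) n)

/-- Condition (A): `Wₙ ⊆ W_{c₁} ⊗ ⋯ ⊗ W_{cₖ}` for each composition `c = (c₁, …, cₖ)`, possibly with
parts equal to zero, of a positive integer `n`. Here `W_{c₁} ⊗ ⋯ ⊗ W_{cₖ}` stands for its image in
`V^{⊗n}`, which is the product of the submodules `W_{cᵢ}` in the tensor algebra `⨁ₙ V^{⊗n}`. -/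
def ConditionA (W : (n : ℕ) → Submodule K (⨂[K]^n V)) : Prop :=
  ∀ n : ℕ, 0 < n → ∀ c : List ℕ, c.sum = n →
    (W n).map (DirectSum.lof K ℕ (fun i : ℕ => ⨂[K]^i V) n) ≤
      (c.map fun m => (W m).map (DirectSum.lof K ℕ (fun i : ℕ => ⨂[K]^i V) m)).prod

variable (K V)

/-- The module `TSⁿ(V)` of symmetric tensors. -/
def symTensors (n : ℕ) : Submodule K (⨂[K]^n V) :=
  ⨅ π : Equiv.Perm (Fin n), LinearMap.eqLocus (permLin K V π) LinearMap.id

variable {K V} in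
theorem mem_symTensors {n : ℕ} {t : ⨂[K]^n V} :
    t ∈ symTensors K V n ↔ ∀ π : Equiv.Perm (Fin n), π • t = t := by
  simp only [symTensors, Submodule.mem_iInf, LinearMap.mem_eqLocus]
  rfl

variable {K V} in
/-- Condition (C): each `Wₙ` consists of symmetric tensors. -/
def ConditionC (W : (n : ℕ) → Submodule K (⨂[K]^n V)) : Prop :=
  ∀ n : ℕ, W n ≤ symTensors K V n

/-- The Novelli-Thibon bialgebra `NT(V) = Σ(TS(V))`. -/
def novelliThibon : Submodule K (F K V) := descentAlgebra (symTensors K V)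

end Module

section Coalgebra

variable (K : Type u) [CommRing K] (C : Type v) [AddCommGroup C] [Module K C] [Coalgebra K C]

/-- The iterated coproduct `δₙ : C → C^{⊗n}`, given by `δ₀ = ε` and `δₙ₊₁ = (δₙ ⊗ id) ∘ δ`. By the
counit law, `δ₁ = id`. -/
def iterComul : (n : ℕ) → C →ₗ[K] ⨂[K]^n C
  | 0 => (TensorPower.algebraMap₀ (R := K) (M := C)).toLinearMap ∘ₗ Coalgebra.counit
  | n + 1 => (TensorPower.mulEquiv (R := K) (M := C) (n := n) (m := 1)).toLinearMap ∘ₗ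
      TensorProduct.map (iterComul n)
        (PiTensorProduct.subsingletonEquiv (R := K) (s := fun _ => C) (0 : Fin 1)).symm.toLinearMap
      ∘ₗ Coalgebra.comul

/-- The Mantaci-Reutenauer bialgebra `MR(C) = Σ(W)`, where `Wₙ` is the image of `δₙ`. -/
def mantaciReutenauer : Submodule K (F K C) :=
  descentAlgebra fun n => LinearMap.range (iterComul K C n)

end Coalgebra

section Algebra

variable {K : Type u} [CommRing K] {A : Type v} [Ring A] [Algebra K A]

/-- `𝔖ₙ` acts on the algebra `A^{⊗n}` by automorphisms of algebra. This makes
`𝓕ₙ(A) = A^{⊗n} # K𝔖ₙ` the twisted group ring, with the internal product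
`(a # σ) * (b # τ) = (a (σ • b)) # (σ τ)` and the unit `1^{⊗n} # eₙ`. -/
instance permMulAction (n : ℕ) : MulSemiringAction (Equiv.Perm (Fin n)) (⨂[K]^n A) where
  __ := permAction K A n
  smul_one π := perm_smul_tprod π 1
  smul_mul π x y := by
    change permLin K A π (x * y) = permLin K A π x * permLin K A π y
    induction x using PiTensorProduct.induction_on with
    | add x x' hx hx' => simp only [add_mul, map_add, hx, hx']
    | smul_tprod r a =>
      induction y using PiTensorProduct.induction_on with
      | add y y' hy hy' => simp only [mul_add, map_add, hy, hy']
      | smul_tprod s b =>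
        simp only [PiTensorProduct.smul_tprod_mul_smul_tprod, map_smul, permLin,
          LinearEquiv.coe_coe, PiTensorProduct.reindex_tprod]
        rfl

theorem sharp_mul_sharp {n : ℕ} (σ τ : Equiv.Perm (Fin n)) (a b : ⨂[K]^n A) :
    (SkewMonoidAlgebra.single σ a * SkewMonoidAlgebra.single τ b : FComp K A n) =
      SkewMonoidAlgebra.single (σ * τ) (a * σ • b) :=
  SkewMonoidAlgebra.single_mul_single

/-- Condition (B): each `Bₙ` is a subalgebra of `A^{⊗n}`. It is not required to contain
`1^{⊗n}`. -/
def ConditionB (B : (n : ℕ) → Submodule K (⨂[K]^n A)) : Prop :=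
  ∀ n : ℕ, ∀ x ∈ B n, ∀ y ∈ B n, x * y ∈ B n

/-- `S` is a graded submodule of `𝓕(A)` and each `S ∩ 𝓕ₙ(A)` is a subalgebra of `𝓕ₙ(A)`, not
required to contain `1^{⊗n} # eₙ`. -/
structure IsInternalSubalgebra (S : Submodule K (F K A)) : Prop where
  graded : ∀ x ∈ S, ∀ n : ℕ, x n ∈ component S n
  mul_mem : ∀ n : ℕ, ∀ x ∈ component S n, ∀ y ∈ component S n, x * y ∈ component S n

end Algebra

end FreeQSym

end

/-!
For a monotone word `w` in which the letters occur `c₁, …, cₖ` times, the product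
`(t₁ # e) * ⋯ * (tₖ # e)` equals `∑ π • (t # e)`, where `t = t₁ ⊗ ⋯ ⊗ tₖ` and `π` runs over the
permutations that increase on each fiber of `w`, called the shuffles of `w`. These sums span `Σ(B)`.

The internal product of two of them, for words `v`, `w` and tensors `t`, `s`, is
`∑ (π ρ) • ((ρ⁻¹ • t) s # e)`, where `π` and `ρ` run over the shuffles of `v` and of `w`. Group the
terms by the word `v ∘ ρ`. By (C), `ρ⁻¹ • t` depends on `ρ` only through this word, and the products
`π ρ` in a group are exactly the shuffles of the word `i ↦ (w i, v (ρ i))`, each obtained once, as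
in Solomon's Mackey formula. By (A), both `ρ⁻¹ • t` and `s` are sums of tensors adapted to this
finer word, and by (B) so is their product.

Symmetric tensors of a free module satisfy (A) because an orbit sum of words of length `n + m` is a
sum of products of orbit sums of words of lengths `n` and `m`. A projective module is a direct
summand of a free one.
For the iterated coproducts, `δₙ` is the `n`-th convolution power of the inclusion of `C` in its
tensor algebra. Hence `δₙ₊ₘ` is the convolution product of `δₙ` and `δₘ`, which is (A).
Cocommutativity gives (C), and since `δ` is a map of algebras so is `δₙ`, which is (B).
-/

noncomputable section

namespace FreeQSym

/-! ### Shuffles of a word -/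

section WordShuffles

variable {n : ℕ} {L M : Type*}

open Classical in
/-- The permutations of the positions of a word that increase on each of its fibers, the fibers
being the sets of positions that carry a given letter. For a monotone word these are the minimal
representatives of the cosets of a Young subgroup. -/
def wordShuffles (w : Fin n → L) : Finset (Equiv.Perm (Fin n)) :=
  Finset.univ.filter fun π => ∀ i j, i < j → w i = w j → π i < π j

theorem mem_wordShuffles {w : Fin n → L} {π : Equiv.Perm (Fin n)} :
    π ∈ wordShuffles w ↔ ∀ i j, i < j → w i = w j → π i < π j := by
  simp only [wordShuffles, Finset.mem_filter_univ]

theorem wordShuffles_congr {w : Fin n → L} {w' : Fin n → M}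
    (h : ∀ i j, w i = w j ↔ w' i = w' j) : wordShuffles w = wordShuffles w' := by
  ext π
  simp only [mem_wordShuffles, h]

theorem one_mem_wordShuffles (w : Fin n → L) : 1 ∈ wordShuffles w :=
  mem_wordShuffles.2 fun _ _ h _ => h

theorem wordShuffles_const (l : L) : wordShuffles (fun _ : Fin n => l) = {1} := by
  ext π
  rw [mem_wordShuffles, Finset.mem_singleton]
  refine ⟨fun h => ?_, fun h => h ▸ fun _ _ hij _ => hij⟩
  have hπ : StrictMono π := fun i j hij => h i j hij rfl
  exact Equiv.ext fun i => Fin.ext_iff.2 <| congrArg Fin.val <|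
    congrFun (hπ.range_inj strictMono_id |>.1 (by simp)) i

/-- The word whose letters are the pairs of letters of `w` and of `u`, compared lexicographically.
Its fibers are the intersections of the fibers of `w` with those of `u`. -/
def pairWord (w : Fin n → M) (u : Fin n → L) : Fin n → M ×ₗ L := fun i => toLex (w i, u i)

theorem pairWord_eq_iff {w : Fin n → M} {u : Fin n → L} {i j : Fin n} :
    pairWord w u i = pairWord w u j ↔ w i = w j ∧ u i = u j := by
  simp only [pairWord, EmbeddingLike.apply_eq_iff_eq, Prod.mk.injEq]

variable [LinearOrder L]

theorem monotone_pairWord [LinearOrder M] {v : Fin n → L} {w : Fin n → M} (hv : Monotone v)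
    (hw : Monotone w) {ρ : Equiv.Perm (Fin n)} (hρ : ρ ∈ wordShuffles w) :
    Monotone (pairWord w (v ∘ ρ)) := by
  intro i j hij
  refine Prod.Lex.toLex_le_toLex.2 ((hw hij).lt_or_eq.imp_right fun h => ⟨h, hv ?_⟩)
  rcases hij.eq_or_lt with rfl | hlt
  · exact le_rfl
  · exact (mem_wordShuffles.1 hρ i j hlt h).le

/- Sorting `v ∘ τ⁻¹` yields the unique factorization of `τ` as a shuffle of `v` times an element of
the stabilizer of `v`. -/
theorem eq_sort_iff_mem_wordShuffles {v : Fin n → L} (hv : Monotone v)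
    {τ π : Equiv.Perm (Fin n)} :
    π = Tuple.sort (v ∘ τ) ↔ π ∈ wordShuffles v ∧ v ∘ τ ∘ π = v := by
  rw [Tuple.eq_sort_iff, mem_wordShuffles]
  have hmono : Monotone ((v ∘ τ) ∘ π) ↔ v ∘ τ ∘ π = v := by
    refine ⟨fun h => ?_, fun h => by rwa [Function.comp_assoc, h]⟩
    have := Tuple.unique_monotone (σ := π) (τ := τ⁻¹) h
      (by rwa [Function.comp_assoc, ← Equiv.Perm.coe_mul, mul_inv_cancel])
    rw [← Function.comp_assoc, this, Function.comp_assoc, ← Equiv.Perm.coe_mul, mul_inv_cancel]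
    rfl
  rw [hmono, and_comm]
  refine and_congr_left fun h => ?_
  have hπ (i) : (v ∘ τ) (π i) = v i := congrFun h i
  simp only [hπ]

theorem mul_mem_wordShuffles_pairWord_iff {v : Fin n → L} {w : Fin n → M} (hv : Monotone v)
    {π ρ ρ₀ : Equiv.Perm (Fin n)} (hπ : π ∈ wordShuffles v) (hρ₀ : ρ₀ ∈ wordShuffles w)
    (hρ : v ∘ ρ = v ∘ ρ₀) :
    π * ρ ∈ wordShuffles (pairWord w (v ∘ ρ₀)) ↔ ρ ∈ wordShuffles w := by
  have hρ' (i) : (v ∘ ρ₀) i = v (ρ i) := (congrFun hρ i).symm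
  rw [mem_wordShuffles] at hπ hρ₀
  simp only [mem_wordShuffles, pairWord_eq_iff, hρ', Equiv.Perm.mul_apply]
  refine ⟨fun h i j hij hw => ?_, fun h i j hij hw => hπ _ _ (h i j hij hw.1) hw.2⟩
  by_contra! hle
  have hvle : v (ρ i) ≤ v (ρ j) := by
    simpa only [← hρ', Function.comp_apply] using hv (hρ₀ i j hij hw).le
  have hveq : v (ρ i) = v (ρ j) := hvle.antisymm (hv hle)
  have hlt : ρ j < ρ i := lt_of_le_of_ne hle fun he => hij.ne' (ρ.injective he)
  exact (hπ _ _ hlt hveq.symm).asymm (h i j hij ⟨hw, hveq⟩)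

open Classical in
theorem sum_wordShuffles_pairWord {X : Type*} [AddCommMonoid X] {v : Fin n → L} {w : Fin n → M}
    (hv : Monotone v) {ρ₀ : Equiv.Perm (Fin n)} (hρ₀ : ρ₀ ∈ wordShuffles w)
    (f : Equiv.Perm (Fin n) → X) :
    ∑ τ ∈ wordShuffles (pairWord w (v ∘ ρ₀)), f τ =
      ∑ ρ ∈ (wordShuffles w).filter fun ρ : Equiv.Perm (Fin n) => v ∘ ρ = v ∘ ρ₀,
        ∑ π ∈ wordShuffles v, f (π * ρ) := by
  rw [← Finset.sum_product']
  let sortPart (τ : Equiv.Perm (Fin n)) := Tuple.sort (v ∘ (ρ₀ * τ⁻¹ : Equiv.Perm (Fin n)))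
  have hsort {τ π} : π = sortPart τ ↔
      π ∈ wordShuffles v ∧ v ∘ (π⁻¹ * τ : Equiv.Perm (Fin n)) = v ∘ ρ₀ := by
    rw [eq_sort_iff_mem_wordShuffles hv]
    refine and_congr_right fun _ => ⟨fun h => ?_, fun h => ?_⟩
    · nth_rw 1 [← h]
      ext i
      simp
    · rw [← Function.comp_assoc, Equiv.Perm.coe_mul, ← Function.comp_assoc, ← h]
      ext i
      simp
  symm
  refine Finset.sum_nbij' (fun p => p.2 * p.1)
    (fun τ => ((sortPart τ)⁻¹ * τ, sortPart τ))
    ?_ ?_ ?_ (fun τ _ => mul_inv_cancel_left _ _) (fun _ _ => rfl)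
  · rintro ⟨ρ, π⟩ h
    obtain ⟨⟨hρ, hv'⟩, hπ⟩ := by simpa only [Finset.mem_product, Finset.mem_filter] using h
    exact (mul_mem_wordShuffles_pairWord_iff hv hπ hρ₀ hv').2 hρ
  · intro τ hτ
    obtain ⟨hπ, hv'⟩ := hsort.1 (rfl : sortPart τ = sortPart τ)
    rw [Finset.mem_product, Finset.mem_filter]
    refine ⟨⟨(mul_mem_wordShuffles_pairWord_iff hv hπ hρ₀ hv').1 ?_, hv'⟩, hπ⟩
    rwa [mul_inv_cancel_left]
  · rintro ⟨ρ, π⟩ h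
    obtain ⟨⟨-, hv'⟩, hπ⟩ := by simpa only [Finset.mem_product, Finset.mem_filter] using h
    have : sortPart (π * ρ) = π := (hsort.2 ⟨hπ, by rwa [inv_mul_cancel_left]⟩).symm
    simp only [this, inv_mul_cancel_left]

end WordShuffles

section PermProd

variable {n m : ℕ} {L : Type*}

@[simp]
theorem permProd_castAdd (σ : Equiv.Perm (Fin n)) (σ' : Equiv.Perm (Fin m)) (i : Fin n) :
    permProd σ σ' (Fin.castAdd m i) = Fin.castAdd m (σ i) := by
  simp [permProd, Equiv.permCongr_apply]

@[simp]
theorem permProd_natAdd (σ : Equiv.Perm (Fin n)) (σ' : Equiv.Perm (Fin m)) (i : Fin m) :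
    permProd σ σ' (Fin.natAdd n i) = Fin.natAdd n (σ' i) := by
  simp [permProd, Equiv.permCongr_apply]

theorem permProd_inv (σ : Equiv.Perm (Fin n)) (σ' : Equiv.Perm (Fin m)) :
    (permProd σ σ')⁻¹ = permProd σ⁻¹ σ'⁻¹ := by
  rw [inv_eq_iff_mul_eq_one]
  exact Equiv.ext ((Fin.forall_fin_add _).2 (by simp))

theorem permProd_inj {σ τ : Equiv.Perm (Fin n)} {σ' τ' : Equiv.Perm (Fin m)} :
    permProd σ σ' = permProd τ τ' ↔ σ = τ ∧ σ' = τ' := by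
  simp [Equiv.ext_iff, Fin.forall_fin_add]

/-- The word that is `false` on the first `n` positions and `true` on the last `m` ones. Its
stabilizer is `𝔖ₙ × 𝔖ₘ`. -/
def blockWord (n m : ℕ) : Fin (n + m) → Bool := Fin.append (fun _ => false) fun _ => true

theorem monotone_append [Preorder L] {v : Fin n → L} {w : Fin m → L} (hv : Monotone v)
    (hw : Monotone w) (h : ∀ i j, v i ≤ w j) : Monotone (Fin.append v w) := by
  simp only [Monotone, Fin.forall_fin_add, Fin.append_left, Fin.append_right, Fin.le_def,
    Fin.val_castAdd, Fin.val_natAdd]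
  exact ⟨fun i => ⟨fun j hij => hv hij, fun j _ => h i j⟩,
    fun i => ⟨fun j hij => by omega, fun j hij => hw (Fin.le_def.2 (by omega))⟩⟩

theorem monotone_blockWord : Monotone (blockWord n m) :=
  monotone_append monotone_const monotone_const fun _ _ => Bool.false_le _

theorem wordShuffles_blockWord : wordShuffles (blockWord n m) = shuffles n m := by
  ext π
  rw [mem_wordShuffles, shuffles, Finset.mem_filter_univ]
  simp [Fin.forall_fin_add, blockWord, StrictMono,
    (Fin.strictMono_castAdd m).lt_iff_lt]

theorem exists_permProd_of_blockWord_comp {ρ : Equiv.Perm (Fin (n + m))}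
    (h : blockWord n m ∘ ρ = blockWord n m) : ∃ σ σ', permProd σ σ' = ρ := by
  have hmaps : Set.MapsTo (finSumFinEquiv.symm.permCongr ρ)
      (Set.range (Sum.inl : Fin n → Fin n ⊕ Fin m)) (Set.range Sum.inl) := by
    rintro _ ⟨i, rfl⟩
    have hi : blockWord n m (ρ (Fin.castAdd m i)) = false := by
      simpa [blockWord] using congrFun h (Fin.castAdd m i)
    obtain ⟨j, hj⟩ : ∃ j, Fin.castAdd m j = ρ (Fin.castAdd m i) := by
      generalize ρ (Fin.castAdd m i) = k at hi ⊢
      induction k using Fin.addCases with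
      | left j => exact ⟨j, rfl⟩
      | right j => simp [blockWord] at hi
    exact ⟨j, by simp [Equiv.permCongr_apply, ← hj]⟩
  obtain ⟨⟨σ, σ'⟩, hσ⟩ := Equiv.Perm.mem_sumCongrHom_range_of_perm_mapsTo_inl hmaps
  refine ⟨σ, σ', ?_⟩
  change finSumFinEquiv.permCongr (Equiv.Perm.sumCongrHom _ _ (σ, σ')) = ρ
  rw [hσ]
  ext i
  simp [Equiv.permCongr_apply]

theorem permProd_mem_wordShuffles_append {v : Fin n → L} {w : Fin m → L} (h : ∀ i j, v i ≠ w j)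
    {σ : Equiv.Perm (Fin n)} {σ' : Equiv.Perm (Fin m)} :
    permProd σ σ' ∈ wordShuffles (Fin.append v w) ↔ σ ∈ wordShuffles v ∧ σ' ∈ wordShuffles w := by
  simp [mem_wordShuffles, Fin.forall_fin_add, h, fun i j => (h i j).symm,
    (Fin.strictMono_castAdd m).lt_iff_lt]

open Classical in
theorem filter_wordShuffles_append {v : Fin n → L} {w : Fin m → L} (h : ∀ i j, v i ≠ w j) :
    ((wordShuffles (Fin.append v w)).filter fun ρ : Equiv.Perm (Fin (n + m)) =>
        blockWord n m ∘ ρ = blockWord n m) =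
      (wordShuffles v ×ˢ wordShuffles w).image fun p => permProd p.1 p.2 := by
  ext ρ
  simp only [Finset.mem_filter, Finset.mem_image, Finset.mem_product, Prod.exists]
  constructor
  · rintro ⟨hρ, hb⟩
    obtain ⟨σ, σ', rfl⟩ := exists_permProd_of_blockWord_comp hb
    exact ⟨σ, σ', (permProd_mem_wordShuffles_append h).1 hρ, rfl⟩
  · rintro ⟨σ, σ', hσ, rfl⟩
    refine ⟨(permProd_mem_wordShuffles_append h).2 hσ, funext ((Fin.forall_fin_add _).2 ?_)⟩
    simp [blockWord]

theorem sum_wordShuffles_append {X : Type*} [AddCommMonoid X] {v : Fin n → L} {w : Fin m → L}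
    (h : ∀ i j, v i ≠ w j) (f : Equiv.Perm (Fin (n + m)) → X) :
    ∑ τ ∈ wordShuffles (Fin.append v w), f τ =
      ∑ σ ∈ wordShuffles v, ∑ σ' ∈ wordShuffles w, ∑ π ∈ shuffles n m, f (π * permProd σ σ') := by
  classical
  have hpair : wordShuffles (Fin.append v w) =
      wordShuffles (pairWord (Fin.append v w) (blockWord n m ∘ (1 : Equiv.Perm (Fin (n + m))))) :=
    wordShuffles_congr <| by
      simp [pairWord_eq_iff, Fin.forall_fin_add, blockWord, h, fun i j => (h i j).symm]
  rw [hpair, sum_wordShuffles_pairWord monotone_blockWord (one_mem_wordShuffles _),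
    Equiv.Perm.coe_one, Function.comp_id, filter_wordShuffles_append h, Finset.sum_image,
    Finset.sum_product, wordShuffles_blockWord]
  exact fun p _ q _ hpq => Prod.ext_iff.2 (permProd_inj.1 hpq)

end PermProd

section TensorMul

variable {K : Type*} [CommRing K] {V : Type*} [AddCommGroup V] [Module K V]

theorem permLin_apply {n : ℕ} (π : Equiv.Perm (Fin n)) (t : ⨂[K]^n V) :
    permLin K V π t = π • t := rfl

instance permSMulCommClass (n : ℕ) : SMulCommClass (Equiv.Perm (Fin n)) K (⨂[K]^n V) where
  smul_comm π r t := map_smul (permLin K V π) r t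

variable (K V) in
/-- The multiplication `V^{⊗n} × V^{⊗m} → V^{⊗(n+m)}` of the tensor algebra, as a bilinear map. -/
def tensorMul (n m : ℕ) : ⨂[K]^n V →ₗ[K] ⨂[K]^m V →ₗ[K] ⨂[K]^(n + m) V :=
  (TensorProduct.mk K (⨂[K]^n V) (⨂[K]^m V)).compr₂
    (TensorPower.mulEquiv (R := K) (M := V)).toLinearMap

theorem tensorMul_apply {n m : ℕ} (t : ⨂[K]^n V) (s : ⨂[K]^m V) :
    tensorMul K V n m t s = TensorPower.mulEquiv (t ⊗ₜ[K] s) := rfl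

theorem tensorMul_tprod {n m : ℕ} (a : Fin n → V) (b : Fin m → V) :
    tensorMul K V n m (PiTensorProduct.tprod K a) (PiTensorProduct.tprod K b) =
      PiTensorProduct.tprod K (Fin.append a b) :=
  TensorPower.tprod_mul_tprod K a b

theorem permProd_smul_tensorMul {n m : ℕ} (σ : Equiv.Perm (Fin n)) (σ' : Equiv.Perm (Fin m))
    (t : ⨂[K]^n V) (s : ⨂[K]^m V) :
    permProd σ σ' • tensorMul K V n m t s = tensorMul K V n m (σ • t) (σ' • s) := by
  suffices h : (tensorMul K V n m).compr₂ (permLin K V (permProd σ σ')) =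
      (tensorMul K V n m).compl₁₂ (permLin K V σ) (permLin K V σ') from
    LinearMap.congr_fun₂ h t s
  ext a b
  simp only [LinearMap.compMultilinearMap_apply, LinearMap.compr₂_apply, LinearMap.compl₁₂_apply,
    permLin_apply, perm_smul_tprod, tensorMul_tprod, permProd_inv]
  exact congrArg _ (funext ((Fin.forall_fin_add _).2 (by simp)))

/-- Condition (A) for the compositions with two positive parts. -/
def SplitsInTwo (W : (n : ℕ) → Submodule K (⨂[K]^n V)) : Prop :=
  ∀ n m : ℕ, 0 < n → 0 < m → W (n + m) ≤ Submodule.map₂ (tensorMul K V n m) (W n) (W m)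

theorem ConditionA.splitsInTwo {W : (n : ℕ) → Submodule K (⨂[K]^n V)} (hW : ConditionA W) :
    SplitsInTwo W := by
  intro n m hn _
  let ι (k : ℕ) : ⨂[K]^k V →ₗ[K] ⨁ k : ℕ, ⨂[K]^k V := DirectSum.lof K ℕ (fun k => ⨂[K]^k V) k
  have hprod : (W n).map (ι n) * (W m).map (ι m) ≤
      (Submodule.map₂ (tensorMul K V n m) (W n) (W m)).map (ι (n + m)) := by
    rw [Submodule.mul_le]
    rintro _ ⟨x, hx, rfl⟩ _ ⟨y, hy, rfl⟩
    exact ⟨tensorMul K V n m x y, Submodule.apply_mem_map₂ _ hx hy,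
      (DirectSum.of_mul_of (A := fun k : ℕ => ⨂[K]^k V) x y).symm⟩
  have hsum : (W (n + m)).map (ι (n + m)) ≤ (W n).map (ι n) * (W m).map (ι m) := by
    simpa only [List.map_cons, List.map_nil, List.prod_cons, List.prod_nil, mul_one] using
      hW (n + m) (by omega) [n, m] (by simp)
  have hinj : Function.Injective (ι (n + m)) :=
    DFinsupp.single_injective (β := fun k : ℕ => ⨂[K]^k V)
  exact (Submodule.map_le_map_iff_of_injective hinj _ _).1 (hsum.trans hprod)

end TensorMul

/-! ### Placing tensor factors -/

section Insertion

open PiTensorProduct (singleAlgHom)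

variable {K : Type*} [CommRing K] {A : Type*} [Ring A] [Algebra K A] {ι κ μ : Type*}

theorem extend_update_one [DecidableEq ι] [DecidableEq κ] (e : ι ↪ κ) (a : ι → A) (i : ι) (x : A) :
    Function.extend e (Function.update a i x) 1 =
      Function.update (Function.extend e a 1) (e i) x := by
  ext k
  by_cases hk : ∃ j, e j = k
  · obtain ⟨j, rfl⟩ := hk
    by_cases hj : j = i <;> simp [e.injective.extend_apply, hj]
  · have hki : k ≠ e i := fun h => hk ⟨i, h.symm⟩
    simp [Function.extend_apply' _ _ _ hk, hki]

/-- The map of algebras `⨂_ι A → ⨂_κ A` that puts the factors in the places given by the embedding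
`e` of `ι` into `κ` and fills the other places with `1`. -/
def insertion (e : ι ↪ κ) : (⨂[K] _ : ι, A) →ₐ[K] ⨂[K] _ : κ, A :=
  PiTensorProduct.liftAlgHom
    { toFun := fun a => PiTensorProduct.tprod K (Function.extend e a 1)
      map_update_add' := fun a i x y => by
        classical simp only [extend_update_one, MultilinearMap.map_update_add]
      map_update_smul' := fun a i c x => by
        classical simp only [extend_update_one, MultilinearMap.map_update_smul] }
    (congrArg (PiTensorProduct.tprod K) (Function.extend_one e))
    (fun a b => by
      simp only [MultilinearMap.coe_mk, PiTensorProduct.tprod_mul_tprod]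
      rw [← Function.extend_mul, one_mul])

theorem insertion_tprod (e : ι ↪ κ) (a : ι → A) :
    insertion e (PiTensorProduct.tprod K a) = PiTensorProduct.tprod K (Function.extend e a 1) :=
  PiTensorProduct.lift.tprod (s := fun _ : ι => A) a

theorem insertion_comp_singleAlgHom [DecidableEq ι] [DecidableEq κ] (e : ι ↪ κ) (i : ι) :
    (insertion e).comp (singleAlgHom i) = singleAlgHom (R := K) (A := fun _ : κ => A) (e i) := by
  ext a
  simp only [AlgHom.comp_apply, PiTensorProduct.singleAlgHom_apply, insertion_tprod]
  exact congrArg _ ((extend_update_one e 1 i a).trans (by rw [Function.extend_one]; rfl))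

theorem insertion_insertion [Finite ι] (e : ι ↪ κ) (f : κ ↪ μ) (x : ⨂[K] _ : ι, A) :
    insertion f (insertion e x) = insertion (e.trans f) x := by
  classical
  suffices h : (insertion f).comp (insertion e) = insertion (K := K) (A := A) (e.trans f) from
    DFunLike.congr_fun h x
  ext1 i
  rw [AlgHom.comp_assoc]
  simp only [insertion_comp_singleAlgHom, Function.Embedding.trans_apply]

theorem perm_smul_eq_insertion {n : ℕ} (σ : Equiv.Perm (Fin n)) (x : ⨂[K]^n A) :
    σ • x = insertion σ.toEmbedding x := by
  suffices h : permLin K A σ = (insertion σ.toEmbedding).toLinearMap from LinearMap.congr_fun h x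
  ext a
  simp only [LinearMap.compMultilinearMap_apply, permLin_apply, perm_smul_tprod,
    AlgHom.toLinearMap_apply, insertion_tprod, Equiv.coe_toEmbedding]
  exact congrArg _ (funext fun i => (Equiv.extend_apply (f := σ) a 1 i).symm)

theorem insertion_commute {e : ι ↪ μ} {f : κ ↪ μ} (h : ∀ i j, e i ≠ f j) (x : ⨂[K] _ : ι, A)
    (y : ⨂[K] _ : κ, A) : Commute (insertion e x) (insertion f y) := by
  suffices hmul : (LinearMap.mul K (⨂[K] _ : μ, A)).compl₁₂ (insertion e).toLinearMap
      (insertion f).toLinearMap = ((LinearMap.mul K (⨂[K] _ : μ, A)).compl₁₂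
        (insertion f).toLinearMap (insertion e).toLinearMap).flip from
    LinearMap.congr_fun₂ hmul x y
  ext a b
  simp only [LinearMap.compMultilinearMap_apply, LinearMap.flip_apply, LinearMap.compl₁₂_apply,
    LinearMap.mul_apply', AlgHom.toLinearMap_apply, insertion_tprod,
    PiTensorProduct.tprod_mul_tprod]
  refine congrArg _ (funext fun k => ?_)
  by_cases hk : ∃ i, e i = k
  · have hk' : ¬∃ j, f j = k := fun ⟨j, hj⟩ => hk.elim fun i hi => h i j (hi.trans hj.symm)
    simp [Function.extend_apply' _ _ _ hk']
  · simp [Function.extend_apply' _ _ _ hk]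

theorem castAdd_ne_natAdd {n m : ℕ} (i : Fin n) (j : Fin m) :
    Fin.castAdd m i ≠ Fin.natAdd n j := by
  rw [Ne, Fin.ext_iff, Fin.val_castAdd, Fin.val_natAdd]
  omega

theorem tensorMul_eq_compl₁₂ (n m : ℕ) : tensorMul K A n m =
    (LinearMap.mul K (⨂[K]^(n + m) A)).compl₁₂ (insertion (Fin.castAddEmb m)).toLinearMap
      (insertion (Fin.natAddEmb n)).toLinearMap := by
  ext a b
  simp only [LinearMap.compMultilinearMap_apply, LinearMap.compl₁₂_apply, LinearMap.mul_apply',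
    AlgHom.toLinearMap_apply, insertion_tprod, PiTensorProduct.tprod_mul_tprod, tensorMul_tprod]
  refine congrArg _ (funext ((Fin.forall_fin_add _).2 ⟨fun i => ?_, fun j => ?_⟩))
  · have hi : ¬∃ j, Fin.natAddEmb n j = Fin.castAddEmb m i := fun ⟨j, hj⟩ =>
      castAdd_ne_natAdd i j hj.symm
    rw [Pi.mul_apply, Fin.append_left, ← Fin.castAddEmb_apply, Function.extend_apply' _ _ _ hi,
      (Fin.castAddEmb m).injective.extend_apply, Pi.one_apply, mul_one]
  · have hj : ¬∃ i, Fin.castAddEmb m i = Fin.natAddEmb n j := fun ⟨i, hi⟩ =>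
      castAdd_ne_natAdd i j hi
    rw [Pi.mul_apply, Fin.append_right, ← Fin.natAddEmb_apply, Function.extend_apply' _ _ _ hj,
      (Fin.natAddEmb n).injective.extend_apply, Pi.one_apply, one_mul]

theorem map₂_tensorMul {n m : ℕ} (P : Submodule K (⨂[K]^n A)) (Q : Submodule K (⨂[K]^m A)) :
    Submodule.map₂ (tensorMul K A n m) P Q = P.map (insertion (Fin.castAddEmb m)).toLinearMap *
      Q.map (insertion (Fin.natAddEmb n)).toLinearMap := by
  rw [tensorMul_eq_compl₁₂, Submodule.mul_eq_map₂, Submodule.map₂_map_map]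

theorem insertion_eq_of_range_eq {m n : ℕ} {e e' : Fin m ↪ Fin n}
    (h : Set.range e = Set.range e') {x : ⨂[K]^m A} (hx : x ∈ symTensors K A m) :
    insertion e x = insertion e' x := by
  let σ : Equiv.Perm (Fin m) := (Equiv.ofInjective e e.injective).trans
    ((Equiv.setCongr h).trans (Equiv.ofInjective e' e'.injective).symm)
  have he : e = σ.toEmbedding.trans e' := Function.Embedding.ext fun i => by
    simpa [σ, Equiv.ofInjective] using
      (Equiv.apply_ofInjective_symm e'.injective (Equiv.setCongr h ⟨e i, i, rfl⟩)).symm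
  rw [he, ← insertion_insertion, ← perm_smul_eq_insertion, mem_symTensors.1 hx]

end Insertion

section Placed

variable {K : Type*} [CommRing K] {A : Type*} [Ring A] [Algebra K A]
  {B : (n : ℕ) → Submodule K (⨂[K]^n A)} {m n : ℕ}

variable (B) in
/-- The elements of `B_{|S|}`, put in the places in `S` in increasing order and completed with `1`
in the other places. -/
def placed (S : Finset (Fin n)) : Submodule K (⨂[K]^n A) :=
  (B S.card).map (insertion (S.orderEmbOfFin rfl).toEmbedding).toLinearMap

theorem placed_eq_map (hC : ConditionC B) (e : Fin m ↪ Fin n) {S : Finset (Fin n)}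
    (hS : Set.range e = S) : placed B S = (B m).map (insertion e).toLinearMap := by
  have hm : m = S.card := by
    have hS' : S = Finset.univ.map e := by rw [← Finset.coe_inj, ← hS]; simp
    rw [hS', Finset.card_map, Finset.card_fin]
  subst hm
  refine SetLike.coe_injective (Set.image_congr fun x hx => ?_)
  exact insertion_eq_of_range_eq ((S.range_orderEmbOfFin rfl).trans hS.symm) (hC _ hx)

theorem range_orderEmbOfFin_trans (S : Finset (Fin m)) (e : Fin m ↪ Fin n) :
    Set.range ((S.orderEmbOfFin rfl).toEmbedding.trans e) = e '' S := by
  rw [← S.range_orderEmbOfFin rfl, ← Set.range_comp]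
  rfl

theorem placed_map (hC : ConditionC B) (e : Fin m ↪ Fin n) (S : Finset (Fin m)) :
    placed B (S.map e) = (placed B S).map (insertion e).toLinearMap := by
  rw [placed_eq_map hC _ ((range_orderEmbOfFin_trans S e).trans (Finset.coe_map e S).symm), placed,
    ← Submodule.map_comp]
  exact congrArg (Submodule.map · _) (LinearMap.ext fun x => (insertion_insertion _ e x).symm)

theorem orderEmbOfFin_ne_of_disjoint {S T : Finset (Fin n)} (h : Disjoint S T) (i : Fin S.card)
    (j : Fin T.card) : S.orderEmbOfFin rfl i ≠ T.orderEmbOfFin rfl j := fun hij =>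
  Finset.disjoint_left.1 h (S.orderEmbOfFin_mem rfl i) (hij ▸ T.orderEmbOfFin_mem rfl j)

theorem placed_commute {S T : Finset (Fin n)} (h : Disjoint S T) :
    Commute (placed B S) (placed B T) := by
  refine Submodule.mul_comm_of_commute ?_
  rintro _ ⟨x, -, rfl⟩ _ ⟨y, -, rfl⟩
  exact insertion_commute (orderEmbOfFin_ne_of_disjoint h) x y

theorem placed_mul_placed_le (hB : ConditionB B) (S : Finset (Fin n)) :
    placed B S * placed B S ≤ placed B S := by
  rw [placed, ← Submodule.map_mul]
  exact Submodule.map_mono (Submodule.mul_le.2 (hB _))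

theorem range_append {X : Type*} (v : Fin n → X) (w : Fin m → X) :
    Set.range (Fin.append v w) = Set.range v ∪ Set.range w := by
  ext x
  simp only [Set.mem_union, Set.mem_range, ← not_forall_not (p := fun i => Fin.append v w i = x),
    Fin.forall_fin_add, Fin.append_left, Fin.append_right]
  rw [not_and_or, not_forall_not, not_forall_not]

theorem placed_union_le (hA : SplitsInTwo B) (hC : ConditionC B) {S T : Finset (Fin n)}
    (hS : S.Nonempty) (hT : T.Nonempty) (h : Disjoint S T) :
    placed B (S ∪ T) ≤ placed B S * placed B T := by
  let e := (S.orderEmbOfFin rfl).toEmbedding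
  let f := (T.orderEmbOfFin rfl).toEmbedding
  let ef : Fin (S.card + T.card) ↪ Fin n :=
    Fin.Embedding.append (Set.disjoint_range_iff.2 (orderEmbOfFin_ne_of_disjoint h) :
      Disjoint (Set.range e) (Set.range f))
  have hrange : Set.range ef = (S ∪ T : Finset (Fin n)) := by
    rw [Finset.coe_union, ← S.range_orderEmbOfFin rfl, ← T.range_orderEmbOfFin rfl]
    exact range_append e f
  have he : (Fin.castAddEmb T.card).trans ef = e := Function.Embedding.ext (Fin.append_left e f)
  have hf : (Fin.natAddEmb S.card).trans ef = f := Function.Embedding.ext (Fin.append_right e f)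
  have insertion_comp {k l : ℕ} (g : Fin k ↪ Fin l) (g' : Fin l ↪ Fin n) :
      (insertion g').toLinearMap ∘ₗ (insertion g).toLinearMap =
        (insertion (K := K) (A := A) (g.trans g')).toLinearMap :=
    LinearMap.ext (insertion_insertion g g')
  have hsplit := Submodule.map_mono (f := (insertion ef).toLinearMap)
    (hA _ _ hS.card_pos hT.card_pos)
  rwa [map₂_tensorMul, Submodule.map_mul, ← Submodule.map_comp, ← Submodule.map_comp,
    insertion_comp, insertion_comp, he, hf, ← placed_eq_map hC ef hrange] at hsplit

end Placed

section WordTensors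

variable {K : Type*} [CommRing K] {A : Type*} [Ring A] [Algebra K A]
  {B : (n : ℕ) → Submodule K (⨂[K]^n A)} {m n : ℕ} {L M : Type*}

open Classical in
/-- The fiber of the word `w` over the letter `l`. -/
def positions (w : Fin n → L) (l : L) : Finset (Fin n) := Finset.univ.filter fun i => w i = l

theorem mem_positions {w : Fin n → L} {l : L} {i : Fin n} : i ∈ positions w l ↔ w i = l := by
  simp only [positions, Finset.mem_filter_univ]

theorem disjoint_positions (w : Fin n → L) {k l : L} (h : k ≠ l) :
    Disjoint (positions w k) (positions w l) :=
  Finset.disjoint_left.2 fun _ hk hl => h ((mem_positions.1 hk).symm.trans (mem_positions.1 hl))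

variable (B) in
theorem pairwise_commute_placed_positions (w : Fin n → L) (I : Set L) :
    I.Pairwise (Function.onFun Commute (placed B ∘ positions w)) := fun _ _ _ _ h =>
  placed_commute (disjoint_positions w h)

variable (B) in
/-- The product of the commuting submodules `placed B (positions w l)`, where `l` runs over `I`. -/
def letterTensors (w : Fin n → L) (I : Finset L) : Submodule K (⨂[K]^n A) :=
  I.noncommProd (placed B ∘ positions w) (pairwise_commute_placed_positions B w I)

open Classical in
/-- The set of the letters that occur in the word `w`. -/
def letters (w : Fin n → L) : Finset L := Finset.univ.image w

theorem mem_letters {w : Fin n → L} {l : L} : l ∈ letters w ↔ ∃ i, w i = l := by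
  simp only [letters, Finset.mem_image, Finset.mem_univ, true_and]

variable (B) in
/-- The analogue of `B_{c₁} ⊗ ⋯ ⊗ B_{cₖ} ⊆ A^{⊗n}` for the partition of the `n` places into the
fibers of the word `w`, which are not assumed to be intervals. -/
def wordTensors (w : Fin n → L) : Submodule K (⨂[K]^n A) := letterTensors B w (letters w)

theorem letterTensors_cons {w : Fin n → L} {I : Finset L} {l : L} (hl : l ∉ I) :
    letterTensors B w (Finset.cons l I hl) = placed B (positions w l) * letterTensors B w I :=
  Finset.noncommProd_cons _ _ _ hl _

theorem letterTensors_union [DecidableEq L] {w : Fin n → L} {I J : Finset L} (h : Disjoint I J) :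
    letterTensors B w (I ∪ J) = letterTensors B w I * letterTensors B w J :=
  Finset.noncommProd_union_of_disjoint h _ _

theorem letterTensors_mul_letterTensors_le (hB : ConditionB B) (w : Fin n → L) (I : Finset L) :
    letterTensors B w I * letterTensors B w I ≤ letterTensors B w I := by
  induction I using Finset.cons_induction with
  | empty => exact (mul_one _).le
  | cons l I hl ih =>
    have hcomm : Commute (letterTensors B w I) (placed B (positions w l)) :=
      (Finset.noncommProd_commute _ _ _ _ fun k hk =>
        placed_commute (disjoint_positions w (ne_of_mem_of_not_mem hk hl).symm)).symm
    rw [letterTensors_cons, hcomm.mul_mul_mul_comm]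
    exact mul_le_mul' (placed_mul_placed_le hB _) ih

theorem mul_mem_wordTensors (hB : ConditionB B) {w : Fin n → L} {s t : ⨂[K]^n A}
    (hs : s ∈ wordTensors B w) (ht : t ∈ wordTensors B w) : s * t ∈ wordTensors B w :=
  letterTensors_mul_letterTensors_le hB w _ (Submodule.mul_mem_mul hs ht)

theorem letterTensors_eq_map (hC : ConditionC B) (e : Fin m ↪ Fin n) {v : Fin n → L}
    {w : Fin m → L} {I : Finset L} (h : ∀ l ∈ I, positions v l = (positions w l).map e) :
    letterTensors B v I = (letterTensors B w I).map (insertion e).toLinearMap := by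
  refine Eq.trans ?_ (Finset.map_noncommProd _ _ _ (Submodule.mapHom (insertion e))).symm
  exact Finset.noncommProd_congr rfl (fun l hl => (congrArg _ (h l hl)).trans (placed_map hC e _)) _

theorem placed_le_letterTensors (hA : SplitsInTwo B) (hC : ConditionC B) (w : Fin n → L)
    {S : Finset (Fin n)} {J : Finset L} (hJ : J.Nonempty) (hJw : J ⊆ letters w)
    (hS : ∀ i, i ∈ S ↔ w i ∈ J) : placed B S ≤ letterTensors B w J := by
  induction hJ using Finset.Nonempty.cons_induction generalizing S with
  | singleton l =>
    have hSl : S = positions w l := by ext i; rw [hS, mem_positions, Finset.mem_singleton]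
    rw [hSl, letterTensors, Finset.noncommProd_singleton]
    rfl
  | cons l J hl hJ ih =>
    obtain ⟨hlw, hJw⟩ := Finset.cons_subset.1 hJw
    classical
    let T : Finset (Fin n) := Finset.univ.filter fun i => w i ∈ J
    have hT (i) : i ∈ T ↔ w i ∈ J := Finset.mem_filter_univ i
    have hST : S = positions w l ∪ T := by
      ext i; rw [hS, Finset.mem_cons, Finset.mem_union, mem_positions, hT]
    have hdisj : Disjoint (positions w l) T := Finset.disjoint_left.2 fun i hi hi' =>
      hl (mem_positions.1 hi ▸ (hT i).1 hi')
    have hne : (positions w l).Nonempty := (mem_letters.1 hlw).imp fun _ => mem_positions.2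
    have hTne : T.Nonempty := by
      obtain ⟨k, hk⟩ := hJ
      exact (mem_letters.1 (hJw hk)).imp fun i hi => (hT i).2 (by rwa [hi])
    rw [hST, letterTensors_cons]
    exact (placed_union_le hA hC hne hTne hdisj).trans (mul_le_mul' le_rfl (ih hJw hT))

theorem wordTensors_le_of_refines (hA : SplitsInTwo B) (hC : ConditionC B) {v : Fin n → L}
    {w : Fin n → M} (h : ∀ i j, w i = w j → v i = v j) : wordTensors B v ≤ wordTensors B w := by
  classical
  let J (I : Finset L) : Finset M := (Finset.univ.filter fun i => v i ∈ I).image w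
  have mem_J {I : Finset L} (i) : w i ∈ J I ↔ v i ∈ I := by
    simp only [J, Finset.mem_image, Finset.mem_filter_univ]
    exact ⟨fun ⟨k, hk, hki⟩ => h k i hki ▸ hk, fun hi => ⟨i, hi, rfl⟩⟩
  have J_subset (I : Finset L) : J I ⊆ letters w := Finset.image_subset_image (Finset.subset_univ _)
  have letterTensors_le (I : Finset L) (hI : I ⊆ letters v) :
      letterTensors B v I ≤ letterTensors B w (J I) := by
    induction I using Finset.cons_induction with
    | empty =>
      have hJ : J ∅ = ∅ := by simp [J]
      rw [hJ]
      rfl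
    | cons l I hl ih =>
      obtain ⟨hlv, hIv⟩ := Finset.cons_subset.1 hI
      have hunion : J (Finset.cons l I hl) = J {l} ∪ J I := by
        rw [Finset.cons_eq_insert, Finset.insert_eq]
        simp only [J, Finset.mem_union, Finset.filter_or, Finset.image_union]
      have hdisj : Disjoint (J {l}) (J I) := Finset.disjoint_left.2 fun k hk hk' => by
        obtain ⟨i, -, rfl⟩ := Finset.mem_image.1 hk
        exact hl (Finset.mem_singleton.1 ((mem_J i).1 hk) ▸ (mem_J i).1 hk')
      have hne : (J {l}).Nonempty :=
        (mem_letters.1 hlv).elim fun i hi => ⟨w i, (mem_J i).2 (Finset.mem_singleton.2 hi)⟩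
      rw [hunion, letterTensors_union hdisj, letterTensors_cons]
      refine mul_le_mul' (placed_le_letterTensors hA hC w hne (J_subset _) fun i => ?_) (ih hIv)
      rw [mem_positions, mem_J, Finset.mem_singleton]
  have hJ : J (letters v) ⊆ letters w := J_subset _
  have hJ' : letters w ⊆ J (letters v) := fun k hk => by
    obtain ⟨i, rfl⟩ := mem_letters.1 hk
    exact (mem_J i).2 (mem_letters.2 ⟨i, rfl⟩)
  calc wordTensors B v ≤ letterTensors B w (J (letters v)) :=
        letterTensors_le (letters v) Finset.Subset.rfl
    _ = wordTensors B w := by rw [hJ.antisymm hJ', wordTensors]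

theorem positions_comp_perm (w : Fin n → L) (σ : Equiv.Perm (Fin n)) (l : L) :
    positions (w ∘ σ) l = (positions w l).map (σ⁻¹ : Equiv.Perm (Fin n)).toEmbedding := by
  ext i
  simp only [mem_positions, Finset.mem_map, Equiv.coe_toEmbedding]
  exact ⟨fun h => ⟨σ i, h, σ.symm_apply_apply i⟩,
    by rintro ⟨j, hj, rfl⟩; simpa using hj⟩

theorem wordTensors_comp_perm (hC : ConditionC B) (w : Fin n → L) (σ : Equiv.Perm (Fin n)) :
    wordTensors B (w ∘ σ) =
      (wordTensors B w).map (insertion (σ⁻¹ : Equiv.Perm (Fin n)).toEmbedding).toLinearMap := by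
  have hletters : letters (w ∘ σ) = letters w := by
    ext l
    rw [mem_letters, mem_letters, σ.surjective.exists (p := fun i => w i = l)]
    rfl
  rw [wordTensors, hletters]
  exact letterTensors_eq_map hC _ fun l _ => positions_comp_perm w σ l

theorem inv_smul_mem_wordTensors (hC : ConditionC B) {w : Fin n → L} (σ : Equiv.Perm (Fin n))
    {t : ⨂[K]^n A} (ht : t ∈ wordTensors B w) : σ⁻¹ • t ∈ wordTensors B (w ∘ σ) := by
  rw [wordTensors_comp_perm hC, perm_smul_eq_insertion]
  exact Submodule.mem_map_of_mem ht

theorem perm_smul_eq_of_mem_wordTensors (hC : ConditionC B) {w : Fin n → L}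
    {σ : Equiv.Perm (Fin n)} (hσ : w ∘ σ = w) {t : ⨂[K]^n A} (ht : t ∈ wordTensors B w) :
    σ • t = t := by
  let fixed : Subalgebra K (⨂[K]^n A) := AlgHom.equalizer (insertion σ.toEmbedding) (AlgHom.id K _)
  have hle : wordTensors B w ≤ Subalgebra.toSubmodule fixed := by
    refine Finset.noncommProd_induction _ _ _ (· ≤ Subalgebra.toSubmodule fixed)
      (fun M N hM hN => (mul_le_mul' hM hN).trans fixed.isIdempotentElem_toSubmodule.le)
      (Submodule.one_le.2 fixed.one_mem) fun l _ => ?_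
    rintro _ ⟨x, hx, rfl⟩
    refine (insertion_insertion _ _ x).trans (insertion_eq_of_range_eq ?_ (hC _ hx))
    have himage : σ '' (positions w l) = positions w l := by
      ext i
      have hi : w (σ.symm i) = w i := by simpa using (congrFun hσ (σ.symm i)).symm
      rw [σ.image_eq_preimage_symm, Set.mem_preimage, Finset.mem_coe, mem_positions, hi,
        Finset.mem_coe, mem_positions]
    rw [range_orderEmbOfFin_trans]
    exact himage.trans ((positions w l).range_orderEmbOfFin rfl).symm
  rw [perm_smul_eq_insertion]
  exact hle ht

theorem wordTensors_const (hC : ConditionC B) (hn : 0 < n) (l : L) :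
    wordTensors B (fun _ : Fin n => l) = B n := by
  have hletters : letters (fun _ : Fin n => l) = {l} := by
    ext k
    rw [mem_letters, Finset.mem_singleton]
    exact ⟨fun ⟨_, h⟩ => h.symm, fun h => ⟨⟨0, hn⟩, h.symm⟩⟩
  have hpos : positions (fun _ : Fin n => l) l = Finset.univ := by ext i; simp [mem_positions]
  rw [wordTensors, hletters, letterTensors, Finset.noncommProd_singleton, Function.comp_apply, hpos,
    placed_eq_map hC (Function.Embedding.refl _) (by rw [Finset.coe_univ]; exact Set.range_id)]
  have hrefl : (insertion (Function.Embedding.refl (Fin n))).toLinearMap =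
      (LinearMap.id : (⨂[K]^n A) →ₗ[K] _) :=
    LinearMap.ext fun x => (perm_smul_eq_insertion 1 x).symm.trans (one_smul _ x)
  rw [hrefl, Submodule.map_id]

theorem wordTensors_append (hC : ConditionC B) {v : Fin n → L} {w : Fin m → L}
    (h : ∀ i j, v i ≠ w j) :
    wordTensors B (Fin.append v w) =
      Submodule.map₂ (tensorMul K A n m) (wordTensors B v) (wordTensors B w) := by
  classical
  have hletters : letters (Fin.append v w) = letters v ∪ letters w := by
    ext l
    simp only [mem_letters, Finset.mem_union, ← Set.mem_range, range_append, Set.mem_union]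
  have hdisj : Disjoint (letters v) (letters w) := Finset.disjoint_left.2 fun l hv hw => by
    obtain ⟨⟨i, rfl⟩, ⟨j, hj⟩⟩ := mem_letters.1 hv, mem_letters.1 hw
    exact h i j hj.symm
  have hv : letterTensors B (Fin.append v w) (letters v) =
      (wordTensors B v).map (insertion (Fin.castAddEmb m)).toLinearMap := by
    refine letterTensors_eq_map hC _ fun l hl => ?_
    obtain ⟨i, rfl⟩ := mem_letters.1 hl
    have hi (j) : w j ≠ v i := (h i j).symm
    exact Finset.ext ((Fin.forall_fin_add _).2 (by simp [mem_positions, hi, castAdd_ne_natAdd]))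
  have hw : letterTensors B (Fin.append v w) (letters w) =
      (wordTensors B w).map (insertion (Fin.natAddEmb n)).toLinearMap := by
    refine letterTensors_eq_map hC _ fun l hl => ?_
    obtain ⟨j, rfl⟩ := mem_letters.1 hl
    have hj (i) : v i ≠ w j := h i j
    exact Finset.ext ((Fin.forall_fin_add _).2
      (by simp [mem_positions, hj, (castAdd_ne_natAdd _ _).symm]))
  rw [wordTensors, hletters, letterTensors_union hdisj, hv, hw, map₂_tensorMul]

end WordTensors

/-! ### The descent algebra -/

section Closure

variable {K : Type*} [CommRing K] {V : Type*} [AddCommGroup V] [Module K V]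
  {W : (n : ℕ) → Submodule K (⨂[K]^n V)} {n m : ℕ}

variable (W) in
theorem extOne_mem_descentAlgebra : extOne K V ∈ descentAlgebra W :=
  Submodule.mem_sInf.2 fun _ hS => hS.1

theorem extMul_mem_descentAlgebra {x y : F K V} (hx : x ∈ descentAlgebra W)
    (hy : y ∈ descentAlgebra W) : extMul K V x y ∈ descentAlgebra W :=
  Submodule.mem_sInf.2 fun S hS =>
    hS.2.1 x (Submodule.mem_sInf.1 hx S hS) y (Submodule.mem_sInf.1 hy S hS)

theorem single_one_mem_component {t : ⨂[K]^n V} (ht : t ∈ W n) :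
    SkewMonoidAlgebra.single 1 t ∈ component (descentAlgebra W) n :=
  Submodule.mem_sInf.2 fun _ hS => hS.2.2 n t ht

theorem extMulComp_mem_component {x : FComp K V n} {y : FComp K V m}
    (hx : x ∈ component (descentAlgebra W) n) (hy : y ∈ component (descentAlgebra W) m) :
    extMulComp K V n m x y ∈ component (descentAlgebra W) (n + m) := by
  rw [component, Submodule.mem_comap, ← extMul_lof_lof]
  exact extMul_mem_descentAlgebra hx hy

variable (W) in
theorem single_zero_mem_component (π : Equiv.Perm (Fin 0)) (t : ⨂[K]^0 V) :
    SkewMonoidAlgebra.single π t ∈ component (descentAlgebra W) 0 := by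
  obtain ⟨r, rfl⟩ := (TensorPower.algebraMap₀ (R := K) (M := V)).surjective t
  rw [Subsingleton.elim π 1, TensorPower.algebraMap₀_eq_smul_one, TensorPower.gOne_def,
    ← sharp_apply, map_smul]
  exact Submodule.smul_mem _ r (extOne_mem_descentAlgebra W)

end Closure

section WordSums

variable {K : Type*} [CommRing K] {V : Type*} [AddCommGroup V] [Module K V] {n m : ℕ}
  {L M : Type*}

variable (K V) in
/-- The product of `∑ π` and `u # e`, where `π` runs over the shuffles for the word `w`. When `w` is
the word `1ᶜ¹ ⋯ kᶜᵏ` and `u = t₁ ⊗ ⋯ ⊗ tₖ`, this is `(t₁ # e) * ⋯ * (tₖ # e)`. -/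
def wordSum (w : Fin n → L) : ⨂[K]^n V →ₗ[K] FComp K V n :=
  ∑ π ∈ wordShuffles w, sharp K V π ∘ₗ permLin K V π

theorem wordSum_apply (w : Fin n → L) (u : ⨂[K]^n V) :
    wordSum K V w u = ∑ π ∈ wordShuffles w, SkewMonoidAlgebra.single π (π • u) := by
  simp only [wordSum, LinearMap.sum_apply, LinearMap.comp_apply, sharp_apply, permLin_apply]

theorem wordSum_congr {w : Fin n → L} {w' : Fin n → M} (h : ∀ i j, w i = w j ↔ w' i = w' j) :
    wordSum K V w = wordSum K V w' := by
  rw [wordSum, wordSum, wordShuffles_congr h]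

theorem wordSum_const (l : L) (u : ⨂[K]^n V) :
    wordSum K V (fun _ => l) u = SkewMonoidAlgebra.single 1 u := by
  rw [wordSum_apply, wordShuffles_const, Finset.sum_singleton, one_smul]

theorem extMulComp_wordSum {v : Fin n → L} {w : Fin m → L} (h : ∀ i j, v i ≠ w j)
    (t : ⨂[K]^n V) (s : ⨂[K]^m V) :
    extMulComp K V n m (wordSum K V v t) (wordSum K V w s) =
      wordSum K V (Fin.append v w) (tensorMul K V n m t s) := by
  simp only [wordSum_apply, sum_wordShuffles_append h, map_sum, LinearMap.sum_apply,
    extMulComp_single_single, ← tensorMul_apply, ← permProd_smul_tensorMul, mul_smul]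
  exact Finset.sum_comm

end WordSums

section WordSpan

variable {K : Type*} [CommRing K] {A : Type*} [Ring A] [Algebra K A]
  {B : (n : ℕ) → Submodule K (⨂[K]^n A)} {n m : ℕ}

variable (B) in
/-- The span of the elements `wordSum w u`, where `w` is a monotone word of length `n` and `u` is in
`wordTensors B w`. It turns out to be the component of degree `n` of the descent algebra of `B`. -/
def wordSpan (n : ℕ) : Submodule K (FComp K A n) :=
  Submodule.span K {x | ∃ (L : Type) (_ : LinearOrder L) (w : Fin n → L), Monotone w ∧
    ∃ u ∈ wordTensors B w, wordSum K A w u = x}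

theorem wordSum_mem_wordSpan {L : Type} [LinearOrder L] {w : Fin n → L} (hw : Monotone w)
    {u : ⨂[K]^n A} (hu : u ∈ wordTensors B w) : wordSum K A w u ∈ wordSpan B n :=
  Submodule.subset_span ⟨L, _, w, hw, u, hu, rfl⟩

theorem extMulComp_mem_wordSpan (hA : SplitsInTwo B) (hC : ConditionC B) {x : FComp K A n}
    {y : FComp K A m} (hx : x ∈ wordSpan B n) (hy : y ∈ wordSpan B m) :
    extMulComp K A n m x y ∈ wordSpan B (n + m) := by
  refine LinearMap.BilinMap.apply_apply_mem_of_mem_span (wordSpan B (n + m)) _ _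
    (extMulComp K A n m) ?_ x y hx hy
  rintro _ ⟨L, _, v, hv, t, ht, rfl⟩ _ ⟨M, _, w, hw, s, hs, rfl⟩
  let v' : Fin n → L ⊕ₗ M := Sum.inlₗ ∘ v
  let w' : Fin m → L ⊕ₗ M := Sum.inrₗ ∘ w
  have hv' (i j) : v i = v j ↔ v' i = v' j := (toLex.injective.comp Sum.inl_injective).eq_iff.symm
  have hw' (i j) : w i = w j ↔ w' i = w' j := (toLex.injective.comp Sum.inr_injective).eq_iff.symm
  have hlt (i j) : v' i < w' j := Sum.Lex.inl_lt_inr _ _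
  rw [wordSum_congr hv', wordSum_congr hw', extMulComp_wordSum fun i j => (hlt i j).ne]
  refine wordSum_mem_wordSpan (monotone_append (Sum.Lex.inl_mono.comp hv) (Sum.Lex.inr_mono.comp hw)
    fun i j => (hlt i j).le) ?_
  rw [wordTensors_append hC fun i j => (hlt i j).ne]
  exact Submodule.apply_mem_map₂ _ (wordTensors_le_of_refines hA hC (fun i j => (hv' i j).2) ht)
    (wordTensors_le_of_refines hA hC (fun i j => (hw' i j).2) hs)

theorem wordTensors_zero {L : Type*} (w : Fin 0 → L) : wordTensors B w = ⊤ := by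
  have hone : wordTensors B w = 1 := rfl
  rw [hone, eq_top_iff]
  intro t _
  obtain ⟨r, rfl⟩ := (TensorPower.algebraMap₀ (R := K) (M := A)).surjective t
  have htprod : PiTensorProduct.tprod K (Fin.elim0 : Fin 0 → A) = 1 :=
    congrArg (PiTensorProduct.tprod K) (Subsingleton.elim _ _)
  rw [TensorPower.algebraMap₀_eq_smul_one, TensorPower.gOne_def, htprod]
  exact Submodule.smul_mem _ r (Submodule.one_le.1 le_rfl)

theorem single_one_mem_wordSpan (hC : ConditionC B) {t : ⨂[K]^n A} (ht : n = 0 ∨ t ∈ B n) :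
    SkewMonoidAlgebra.single 1 t ∈ wordSpan B n := by
  rw [← wordSum_const (K := K) (V := A) ()]
  refine wordSum_mem_wordSpan monotone_const ?_
  rcases n.eq_zero_or_pos with rfl | hn
  · rw [wordTensors_zero]
    exact Submodule.mem_top
  · rw [wordTensors_const hC hn]
    exact ht.resolve_left hn.ne'

theorem exists_eq_append_const {L : Type*} [LinearOrder L] {w : Fin n → L} (hw : Monotone w)
    (hn : 0 < n) : ∃ (k m : ℕ) (h : k + m = n) (v : Fin k → L) (l : L), 0 < m ∧ Monotone v ∧
      (∀ i, v i < l) ∧ w ∘ Fin.cast h = Fin.append v fun _ => l := by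
  let last : Fin n := ⟨n - 1, by omega⟩
  have hle (i : Fin n) : w i ≤ w last := hw (Fin.le_def.2 (Nat.le_sub_one_of_lt i.2))
  obtain ⟨k, hk⟩ : ∃ k : ℕ, ∀ i : Fin n, i < k ↔ w i < w last :=
    ⟨_, fun _ => Tuple.lt_card_lt_iff_apply_lt_of_monotone hw⟩
  have hkn : k < n := by
    have := (hk last).not.2 (lt_irrefl _)
    simp only [last] at this
    omega
  generalize w last = l at *
  obtain ⟨m, rfl⟩ := Nat.exists_eq_add_of_le hkn.le
  refine ⟨k, m, rfl, w ∘ Fin.castAdd m, l, by omega,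
    hw.comp (Fin.strictMono_castAdd m).monotone, fun i => (hk _).1 i.2, ?_⟩
  refine funext ((Fin.forall_fin_add _).2 ⟨fun i => ?_, fun j => ?_⟩)
  · rw [Fin.append_left]
    rfl
  · rw [Fin.append_right]
    exact (hle _).antisymm (not_lt.1 ((hk _).not.1 (by simp)))

theorem wordSum_mem_component (hC : ConditionC B) {L : Type*} [LinearOrder L] {w : Fin n → L}
    (hw : Monotone w) {u : ⨂[K]^n A} (hu : u ∈ wordTensors B w) :
    wordSum K A w u ∈ component (descentAlgebra B) n := by
  induction n using Nat.strong_induction_on with | _ n ih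
  rcases n.eq_zero_or_pos with rfl | hn
  · rw [wordSum_apply]
    exact Submodule.sum_mem _ fun π _ => single_zero_mem_component B _ _
  obtain ⟨k, m, rfl, v, l, hm, hv, hvl, hwv⟩ := exists_eq_append_const hw hn
  obtain rfl : w = Fin.append v fun _ => l := hwv
  have hne (i) (j : Fin m) : v i ≠ (fun _ => l) j := (hvl i).ne
  suffices h : wordTensors B (Fin.append v fun _ : Fin m => l) ≤
      (component (descentAlgebra B) (k + m)).comap (wordSum K A (Fin.append v fun _ => l)) from h hu
  rw [wordTensors_append hC hne, wordTensors_const hC hm, Submodule.map₂_le]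
  intro t ht s hs
  rw [Submodule.mem_comap, ← extMulComp_wordSum hne, wordSum_const]
  exact extMulComp_mem_component (ih k (by omega) hv ht) (single_one_mem_component hs)

theorem wordSpan_le_component (hC : ConditionC B) :
    wordSpan B n ≤ component (descentAlgebra B) n := by
  refine Submodule.span_le.2 ?_
  rintro _ ⟨L, _, w, hw, u, hu, rfl⟩
  exact wordSum_mem_component hC hw hu

theorem descentAlgebra_eq_iSup (hA : SplitsInTwo B) (hC : ConditionC B) :
    descentAlgebra B = ⨆ n, (wordSpan B n).map (DirectSum.lof K ℕ (FComp K A) n) := by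
  refine le_antisymm (sInf_le ⟨?_, fun x hx y hy => ?_, fun n t ht => ?_⟩)
    (iSup_le fun n => Submodule.map_le_iff_le_comap.2 (wordSpan_le_component hC))
  · exact Submodule.mem_iSup_of_mem 0 ⟨_, single_one_mem_wordSpan hC (Or.inl rfl), rfl⟩
  · refine (?_ : Submodule.map₂ (extMul K A) _ _ ≤ _) (Submodule.apply_mem_map₂ _ hx hy)
    simp only [Submodule.map₂_iSup_left, Submodule.map₂_iSup_right, iSup_le_iff, Submodule.map₂_le]
    rintro m n _ ⟨a, ha, rfl⟩ _ ⟨b, hb, rfl⟩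
    rw [extMul_lof_lof]
    exact Submodule.mem_iSup_of_mem _ ⟨_, extMulComp_mem_wordSpan hA hC ha hb, rfl⟩
  · exact Submodule.mem_iSup_of_mem n ⟨_, single_one_mem_wordSpan hC (Or.inr ht), rfl⟩

theorem apply_mem_wordSpan (hA : SplitsInTwo B) (hC : ConditionC B) {x : F K A}
    (hx : x ∈ descentAlgebra B) (n : ℕ) : x n ∈ wordSpan B n := by
  suffices h : descentAlgebra B ≤ (wordSpan B n).comap (DirectSum.component K ℕ (FComp K A) n) from
    h hx
  rw [descentAlgebra_eq_iSup hA hC]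
  refine iSup_le fun m => ?_
  rintro _ ⟨y, hy, rfl⟩
  rw [Submodule.mem_comap]
  rcases eq_or_ne m n with rfl | h
  · rwa [DirectSum.component.lof_self]
  · rw [DirectSum.component.of, dif_neg h]
    exact Submodule.zero_mem _

theorem component_descentAlgebra (hA : SplitsInTwo B) (hC : ConditionC B) :
    component (descentAlgebra B) n = wordSpan B n := by
  refine le_antisymm (fun x hx => ?_) (wordSpan_le_component hC)
  have hxn := apply_mem_wordSpan hA hC hx n
  rwa [DirectSum.lof_eq_of, DirectSum.of_eq_same] at hxn

end WordSpan

section InternalProduct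

variable {K : Type*} [CommRing K] {A : Type*} [Ring A] [Algebra K A]
  {B : (n : ℕ) → Submodule K (⨂[K]^n A)} {n : ℕ}

theorem inv_smul_eq_inv_smul (hC : ConditionC B) {L : Type*} {v : Fin n → L} {t : ⨂[K]^n A}
    (ht : t ∈ wordTensors B v) {ρ ρ' : Equiv.Perm (Fin n)} (h : v ∘ ρ = v ∘ ρ') :
    ρ⁻¹ • t = ρ'⁻¹ • t := by
  have hfix : v ∘ (ρ * ρ'⁻¹ : Equiv.Perm (Fin n)) = v := by
    rw [Equiv.Perm.coe_mul, ← Function.comp_assoc, h, Function.comp_assoc, ← Equiv.Perm.coe_mul,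
      mul_inv_cancel, Equiv.Perm.coe_one, Function.comp_id]
  rw [inv_smul_eq_iff, ← mul_smul, perm_smul_eq_of_mem_wordTensors hC hfix ht]

theorem wordSum_mul_wordSum_mem_wordSpan (hA : SplitsInTwo B) (hB : ConditionB B)
    (hC : ConditionC B) {L M : Type} [LinearOrder L] [LinearOrder M] {v : Fin n → L}
    {w : Fin n → M} (hv : Monotone v) (hw : Monotone w) {t s : ⨂[K]^n A}
    (ht : t ∈ wordTensors B v) (hs : s ∈ wordTensors B w) :
    wordSum K A v t * wordSum K A w s ∈ wordSpan B n := by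
  classical
  have hexpand : wordSum K A v t * wordSum K A w s = ∑ ρ ∈ wordShuffles w, ∑ π ∈ wordShuffles v,
      (SkewMonoidAlgebra.single (π * ρ) ((π * ρ) • (ρ⁻¹ • t * s)) : FComp K A n) := by
    simp only [wordSum_apply, Finset.sum_mul_sum, sharp_mul_sharp, smul_mul', ← mul_smul,
      mul_inv_cancel_right]
    exact Finset.sum_comm
  rw [hexpand, ← Finset.sum_fiberwise_of_maps_to
    fun ρ hρ => Finset.mem_image_of_mem (fun ρ : Equiv.Perm (Fin n) => v ∘ ρ) hρ]
  refine Submodule.sum_mem _ fun r hr => ?_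
  obtain ⟨ρ₀, hρ₀, rfl⟩ := Finset.mem_image.1 hr
  have hgroup : ∑ ρ ∈ (wordShuffles w).filter fun ρ : Equiv.Perm (Fin n) => v ∘ ρ = v ∘ ρ₀,
      ∑ π ∈ wordShuffles v,
        (SkewMonoidAlgebra.single (π * ρ) ((π * ρ) • (ρ⁻¹ • t * s)) : FComp K A n) =
      wordSum K A (pairWord w (v ∘ ρ₀)) (ρ₀⁻¹ • t * s) := by
    rw [wordSum_apply, sum_wordShuffles_pairWord hv hρ₀]
    refine Finset.sum_congr rfl fun ρ hρ => ?_
    rw [inv_smul_eq_inv_smul hC ht (Finset.mem_filter.1 hρ).2]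
  rw [hgroup]
  refine wordSum_mem_wordSpan (L := M ×ₗ L) (monotone_pairWord hv hw hρ₀)
    (mul_mem_wordTensors hB ?_ ?_)
  · exact wordTensors_le_of_refines hA hC (fun i j h => (pairWord_eq_iff.1 h).2)
      (inv_smul_mem_wordTensors hC ρ₀ ht)
  · exact wordTensors_le_of_refines hA hC (fun i j h => (pairWord_eq_iff.1 h).1) hs

theorem mul_mem_wordSpan (hA : SplitsInTwo B) (hB : ConditionB B) (hC : ConditionC B)
    {x y : FComp K A n} (hx : x ∈ wordSpan B n) (hy : y ∈ wordSpan B n) : x * y ∈ wordSpan B n := by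
  refine LinearMap.BilinMap.apply_apply_mem_of_mem_span (wordSpan B n) _ _
    (Algebra.lmul K (FComp K A n)).toLinearMap ?_ x y hx hy
  rintro _ ⟨L, _, v, hv, t, ht, rfl⟩ _ ⟨M, _, w, hw, s, hs, rfl⟩
  exact wordSum_mul_wordSum_mem_wordSpan hA hB hC hv hw ht hs

theorem isInternalSubalgebra_descentAlgebra (hA : SplitsInTwo B) (hB : ConditionB B)
    (hC : ConditionC B) : IsInternalSubalgebra (descentAlgebra B) where
  graded x hx n := by
    rw [component_descentAlgebra hA hC]
    exact apply_mem_wordSpan hA hC hx n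
  mul_mem n x hx y hy := by
    rw [component_descentAlgebra hA hC] at *
    exact mul_mem_wordSpan hA hB hC hx hy

end InternalProduct

/-! ### Symmetric tensors -/

section FreeModule

variable {K : Type*} [CommRing K] {V : Type*} [AddCommGroup V] [Module K V] {ι : Type*}

theorem mem_of_sum_fiber_mem {M X Y : Type*} [AddCommGroup M] [Module K M]
    (b : Module.Basis X K M) {F : X → Y} {C : X → Finset X} (hC : ∀ x y, y ∈ C x ↔ F y = F x)
    {N : Submodule K M} (hN : ∀ x, ∑ y ∈ C x, b y ∈ N) {t : M}
    (ht : ∀ x, ∀ y ∈ C x, b.repr t y = b.repr t x) : t ∈ N := by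
  classical
  have hfiber (x) (hx : x ∈ (b.repr t).support) :
      (b.repr t).support.filter (F · = F x) = C x := by
    ext y
    rw [Finset.mem_filter, ← hC, and_iff_right_iff_imp, Finsupp.mem_support_iff]
    exact fun hy => ht x y hy ▸ Finsupp.mem_support_iff.1 hx
  rw [← b.linearCombination_repr t, Finsupp.linearCombination_apply, Finsupp.sum,
    ← Finset.sum_fiberwise_of_maps_to (t := (b.repr t).support.image F)
      fun _ => Finset.mem_image_of_mem F]
  refine N.sum_mem fun c hc => ?_
  obtain ⟨x, hx, rfl⟩ := Finset.mem_image.1 hc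
  rw [hfiber x hx, Finset.sum_congr rfl fun y hy => by rw [ht x y hy], ← Finset.smul_sum]
  exact N.smul_mem _ (hN x)

/-- The basis of `V^{⊗n}` induced by a basis of `V`, indexed by words. -/
def wordBasis (b : Module.Basis ι K V) (n : ℕ) : Module.Basis (Fin n → ι) K (⨂[K]^n V) :=
  Basis.piTensorProduct fun _ => b

theorem wordBasis_apply (b : Module.Basis ι K V) {n : ℕ} (p : Fin n → ι) :
    wordBasis b n p = PiTensorProduct.tprod K (b ∘ p) :=
  Basis.piTensorProduct_apply _ _

theorem smul_wordBasis (b : Module.Basis ι K V) {n : ℕ} (σ : Equiv.Perm (Fin n))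
    (p : Fin n → ι) : σ • wordBasis b n p = wordBasis b n (p ∘ ⇑σ⁻¹) := by
  rw [wordBasis_apply, wordBasis_apply, perm_smul_tprod]
  rfl

theorem tensorMul_wordBasis (b : Module.Basis ι K V) {n m : ℕ} (p : Fin n → ι) (q : Fin m → ι) :
    tensorMul K V n m (wordBasis b n p) (wordBasis b m q) =
      wordBasis b (n + m) (Fin.append p q) := by
  simp only [wordBasis_apply, tensorMul_tprod]
  exact congrArg _ (funext ((Fin.forall_fin_add _).2 (by simp)))

theorem wordBasis_repr_smul (b : Module.Basis ι K V) {n : ℕ} (σ : Equiv.Perm (Fin n))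
    (t : ⨂[K]^n V) (p : Fin n → ι) :
    (wordBasis b n).repr (σ • t) p = (wordBasis b n).repr t (p ∘ σ) := by
  classical
  suffices h : (wordBasis b n).coord p ∘ₗ permLin K V σ = (wordBasis b n).coord (p ∘ σ) from
    LinearMap.congr_fun h t
  refine (wordBasis b n).ext fun r => ?_
  simp only [LinearMap.comp_apply, permLin_apply, smul_wordBasis, Module.Basis.coord_apply,
    Module.Basis.repr_self, Finsupp.single_apply]
  exact if_congr (Equiv.comp_symm_eq σ p r) rfl rfl

open Classical in
/-- The distinct rearrangements of a word. -/
def rearrangements {n : ℕ} (p : Fin n → ι) : Finset (Fin n → ι) :=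
  Finset.univ.image fun σ : Equiv.Perm (Fin n) => p ∘ σ

theorem mem_rearrangements {n : ℕ} {p q : Fin n → ι} :
    q ∈ rearrangements p ↔ ∃ σ : Equiv.Perm (Fin n), p ∘ σ = q := by
  simp only [rearrangements, Finset.mem_image, Finset.mem_univ, true_and]

theorem rearrangements_comp_perm {n : ℕ} (p : Fin n → ι) (σ : Equiv.Perm (Fin n)) :
    rearrangements (p ∘ σ) = rearrangements p := by
  ext q
  simp only [mem_rearrangements]
  exact ((Equiv.mulLeft σ).surjective.exists (p := fun τ => p ∘ τ = q)).symm

theorem mem_rearrangements_iff_eq {n : ℕ} {p q : Fin n → ι} :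
    q ∈ rearrangements p ↔ rearrangements q = rearrangements p := by
  refine ⟨fun h => ?_, fun h => h ▸ mem_rearrangements.2 ⟨1, rfl⟩⟩
  obtain ⟨σ, rfl⟩ := mem_rearrangements.1 h
  exact rearrangements_comp_perm p σ

/-- The monomial symmetric tensor of a word of basis vectors: the sum of its distinct
rearrangements. -/
def orbitSum (b : Module.Basis ι K V) {n : ℕ} (p : Fin n → ι) : ⨂[K]^n V :=
  ∑ q ∈ rearrangements p, wordBasis b n q

theorem orbitSum_mem_symTensors (b : Module.Basis ι K V) {n : ℕ} (p : Fin n → ι) :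
    orbitSum b p ∈ symTensors K V n := by
  refine mem_symTensors.2 fun σ => ?_
  simp only [orbitSum, Finset.smul_sum, smul_wordBasis]
  exact Finset.sum_equiv (Equiv.arrowCongr σ (Equiv.refl ι))
    (fun q => by
      rw [mem_rearrangements_iff_eq, mem_rearrangements_iff_eq, ← rearrangements_comp_perm q σ⁻¹]
      rfl)
    fun q _ => rfl

theorem tensorMul_orbitSum (b : Module.Basis ι K V) {n m : ℕ} (p : Fin n → ι) (q : Fin m → ι) :
    tensorMul K V n m (orbitSum b p) (orbitSum b q) =
      ∑ r ∈ rearrangements p ×ˢ rearrangements q, wordBasis b (n + m) (Fin.append r.1 r.2) := by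
  simp only [orbitSum, map_sum, LinearMap.sum_apply, tensorMul_wordBasis,
    Finset.sum_product_right]

theorem mem_map₂_symTensors (b : Module.Basis ι K V) {n m : ℕ} {t : ⨂[K]^(n + m) V}
    (ht : ∀ (σ : Equiv.Perm (Fin n)) (σ' : Equiv.Perm (Fin m)), permProd σ σ' • t = t) :
    t ∈ Submodule.map₂ (tensorMul K V n m) (symTensors K V n) (symTensors K V m) := by
  refine mem_of_sum_fiber_mem ((wordBasis b (n + m)).reindex (Fin.appendEquiv n m).symm)
    (F := fun r => (rearrangements r.1, rearrangements r.2))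
    (C := fun r => rearrangements r.1 ×ˢ rearrangements r.2) (fun r s => ?_) (fun r => ?_)
    fun r s hs => ?_
  · rw [Finset.mem_product, mem_rearrangements_iff_eq, mem_rearrangements_iff_eq, Prod.mk_inj]
  · simp only [Module.Basis.reindex_apply, Equiv.symm_symm]
    exact tensorMul_orbitSum b r.1 r.2 ▸ Submodule.apply_mem_map₂ _
      (orbitSum_mem_symTensors b r.1) (orbitSum_mem_symTensors b r.2)
  · rw [Finset.mem_product, mem_rearrangements, mem_rearrangements] at hs
    obtain ⟨⟨σ, hσ⟩, σ', hσ'⟩ := hs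
    have happend : Fin.append r.1 r.2 ∘ permProd σ σ' = Fin.append s.1 s.2 :=
      funext ((Fin.forall_fin_add _).2 (by simp [← hσ, ← hσ']))
    simp only [Module.Basis.repr_reindex_apply, Equiv.symm_symm]
    change (wordBasis b _).repr t (Fin.append s.1 s.2) = (wordBasis b _).repr t (Fin.append r.1 r.2)
    rw [← happend, ← wordBasis_repr_smul, ht]

theorem splitsInTwo_symTensors_of_basis (b : Module.Basis ι K V) :
    SplitsInTwo (symTensors K V) :=
  fun _ _ _ _ _ ht => mem_map₂_symTensors b fun _ _ => mem_symTensors.1 ht _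

end FreeModule

section Projective

variable {K : Type*} [CommRing K]

section Functoriality

variable {V W : Type*} [AddCommGroup V] [Module K V] [AddCommGroup W] [Module K W]

theorem map_smul_perm {n : ℕ} (f : V →ₗ[K] W) (σ : Equiv.Perm (Fin n)) (t : ⨂[K]^n V) :
    PiTensorProduct.map (fun _ => f) (σ • t) = σ • PiTensorProduct.map (fun _ => f) t :=
  PiTensorProduct.map_reindex (fun _ => f) σ t

theorem map_mem_symTensors {n : ℕ} (f : V →ₗ[K] W) {t : ⨂[K]^n V} (ht : t ∈ symTensors K V n) :
    PiTensorProduct.map (fun _ => f) t ∈ symTensors K W n :=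
  mem_symTensors.2 fun σ => by rw [← map_smul_perm, mem_symTensors.1 ht]

theorem map_tensorMul {n m : ℕ} (f : V →ₗ[K] W) (x : ⨂[K]^n V) (y : ⨂[K]^m V) :
    PiTensorProduct.map (fun _ => f) (tensorMul K V n m x y) =
      tensorMul K W n m (PiTensorProduct.map (fun _ => f) x)
        (PiTensorProduct.map (fun _ => f) y) := by
  suffices h : (tensorMul K V n m).compr₂ (PiTensorProduct.map fun _ => f) =
      (tensorMul K W n m).compl₁₂ (PiTensorProduct.map fun _ => f)
        (PiTensorProduct.map fun _ => f) from
    LinearMap.congr_fun₂ h x y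
  ext a c
  simp only [LinearMap.compMultilinearMap_apply, LinearMap.compr₂_apply, LinearMap.compl₁₂_apply,
    tensorMul_tprod, PiTensorProduct.map_tprod]
  exact congrArg _ (funext ((Fin.forall_fin_add _).2 (by simp)))

theorem SplitsInTwo.symTensors_of_retract (hV : SplitsInTwo (symTensors K V)) {f : W →ₗ[K] V}
    {g : V →ₗ[K] W} (hgf : g ∘ₗ f = LinearMap.id) : SplitsInTwo (symTensors K W) := by
  intro n m hn hm t ht
  have hle : Submodule.map₂ (tensorMul K V n m) (symTensors K V n) (symTensors K V m) ≤
      (Submodule.map₂ (tensorMul K W n m) (symTensors K W n) (symTensors K W m)).comap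
        (PiTensorProduct.map fun _ => g) := by
    rw [Submodule.map₂_le]
    intro x hx y hy
    rw [Submodule.mem_comap, map_tensorMul]
    exact Submodule.apply_mem_map₂ _ (map_mem_symTensors g hx) (map_mem_symTensors g hy)
  have hmem := hle (hV n m hn hm (map_mem_symTensors f ht))
  rwa [Submodule.mem_comap, ← LinearMap.comp_apply, ← PiTensorProduct.map_comp, hgf,
    PiTensorProduct.map_id] at hmem

end Functoriality

theorem splitsInTwo_symTensors (V : Type*) [AddCommGroup V] [Module K V]
    [Module.Projective K V] : SplitsInTwo (symTensors K V) := by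
  obtain ⟨_, hs⟩ := Module.projective_def'.1 (inferInstance : Module.Projective K V)
  exact (splitsInTwo_symTensors_of_basis Finsupp.basisSingleOne).symTensors_of_retract hs

end Projective

section Algebra

variable {K : Type*} [CommRing K] (A : Type*) [Ring A] [Algebra K A]

theorem conditionB_symTensors : ConditionB (symTensors K A) :=
  fun _ x hx y hy => mem_symTensors.2 fun σ => by
    rw [smul_mul', mem_symTensors.1 hx, mem_symTensors.1 hy]

theorem one_mem_symTensors (n : ℕ) : (1 : ⨂[K]^n A) ∈ symTensors K A n :=
  mem_symTensors.2 smul_one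

end Algebra

/-! ### Iterated coproducts -/

section SwapPermProd

variable {n m : ℕ}

theorem permProd_swap_one (i j : Fin n) : permProd (Equiv.swap i j) (1 : Equiv.Perm (Fin m)) =
    Equiv.swap (Fin.castAdd m i) (Fin.castAdd m j) := by
  rw [permProd, Equiv.Perm.sumCongr_swap_one]
  exact Equiv.symm_trans_swap_trans _ _ finSumFinEquiv

theorem permProd_one_swap (i j : Fin m) : permProd (1 : Equiv.Perm (Fin n)) (Equiv.swap i j) =
    Equiv.swap (Fin.natAdd n i) (Fin.natAdd n j) := by
  rw [permProd, Equiv.Perm.sumCongr_one_swap]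
  exact Equiv.symm_trans_swap_trans _ _ finSumFinEquiv

end SwapPermProd

section Coalgebra

open WithConv (toConv)

variable {K : Type*} [CommRing K] {C : Type*} [AddCommGroup C] [Module K C]

variable (K C) in
theorem lof_comp_mulEquiv (n m : ℕ) :
    DirectSum.lof K ℕ (fun k => ⨂[K]^k C) (n + m) ∘ₗ TensorPower.mulEquiv.toLinearMap =
      LinearMap.mul' K _ ∘ₗ TensorProduct.map (DirectSum.lof K ℕ (fun k => ⨂[K]^k C) n)
        (DirectSum.lof K ℕ (fun k => ⨂[K]^k C) m) :=
  TensorProduct.ext' fun x y => (DirectSum.of_mul_of (A := fun k : ℕ => ⨂[K]^k C) x y).symm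

theorem permProd_smul_mulEquiv {n m : ℕ} (σ : Equiv.Perm (Fin n)) (σ' : Equiv.Perm (Fin m))
    (z : (⨂[K]^n C) ⊗[K] (⨂[K]^m C)) :
    permProd σ σ' • TensorPower.mulEquiv z =
      TensorPower.mulEquiv (TensorProduct.map (permLin K C σ) (permLin K C σ') z) := by
  suffices h : permLin K C (permProd σ σ') ∘ₗ TensorPower.mulEquiv.toLinearMap =
      TensorPower.mulEquiv.toLinearMap ∘ₗ
        TensorProduct.map (permLin K C σ) (permLin K C σ') from
    LinearMap.congr_fun h z
  exact TensorProduct.ext' (permProd_smul_tensorMul σ σ')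

variable [Coalgebra K C]

variable (K C) in
theorem toConv_lof_comp_iterComul (n : ℕ) :
    toConv (DirectSum.lof K ℕ (fun k => ⨂[K]^k C) n ∘ₗ iterComul K C n) =
      toConv (DirectSum.lof K ℕ (fun k => ⨂[K]^k C) 1 ∘ₗ
        (PiTensorProduct.subsingletonEquiv (s := fun _ => C) (0 : Fin 1)).symm.toLinearMap) ^ n :=
  by
  induction n with
  | zero => rfl
  | succ n ih =>
    rw [pow_succ, ← ih, LinearMap.convMul_def, TensorProduct.map_comp, ← LinearMap.comp_assoc,
      ← LinearMap.comp_assoc, ← lof_comp_mulEquiv]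
    rfl

variable (K C) in
theorem iterComul_add (n m : ℕ) : iterComul K C (n + m) = TensorPower.mulEquiv.toLinearMap ∘ₗ
    TensorProduct.map (iterComul K C n) (iterComul K C m) ∘ₗ Coalgebra.comul := by
  have h := toConv_lof_comp_iterComul K C (n + m)
  rw [pow_add, ← toConv_lof_comp_iterComul, ← toConv_lof_comp_iterComul, LinearMap.convMul_def,
    TensorProduct.map_comp, ← LinearMap.comp_assoc, ← LinearMap.comp_assoc, ← lof_comp_mulEquiv,
    LinearMap.comp_assoc, LinearMap.comp_assoc] at h
  exact LinearMap.cancel_left (DFinsupp.single_injective (β := fun k : ℕ => ⨂[K]^k C)) |>.1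
    (WithConv.toConv_injective h)

variable (K C) in
theorem iterComul_one : iterComul K C 1 =
    (PiTensorProduct.subsingletonEquiv (s := fun _ => C) (0 : Fin 1)).symm.toLinearMap := by
  have h := toConv_lof_comp_iterComul K C 1
  rw [pow_one] at h
  exact LinearMap.cancel_left (DFinsupp.single_injective (β := fun k : ℕ => ⨂[K]^k C)) |>.1
    (WithConv.toConv_injective h)

variable (K C) in
theorem splitsInTwo_range_iterComul : SplitsInTwo fun n => LinearMap.range (iterComul K C n) := by
  rintro n m - - _ ⟨x, rfl⟩
  rw [iterComul_add, LinearMap.comp_apply, LinearMap.comp_apply]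
  induction Coalgebra.comul (R := K) x using TensorProduct.induction_on with
  | zero => simp only [map_zero, Submodule.zero_mem]
  | add y z hy hz => simpa only [map_add] using Submodule.add_mem _ hy hz
  | tmul y z => exact Submodule.apply_mem_map₂ _ ⟨y, rfl⟩ ⟨z, rfl⟩

theorem permProd_smul_iterComul {n m : ℕ} {σ : Equiv.Perm (Fin n)} {σ' : Equiv.Perm (Fin m)}
    (hσ : ∀ x, σ • iterComul K C n x = iterComul K C n x)
    (hσ' : ∀ x, σ' • iterComul K C m x = iterComul K C m x) (x : C) :
    permProd σ σ' • iterComul K C (n + m) x = iterComul K C (n + m) x := by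
  have hn : permLin K C σ ∘ₗ iterComul K C n = iterComul K C n := LinearMap.ext hσ
  have hm : permLin K C σ' ∘ₗ iterComul K C m = iterComul K C m := LinearMap.ext hσ'
  rw [iterComul_add, LinearMap.comp_apply, LinearMap.comp_apply, LinearEquiv.coe_coe,
    permProd_smul_mulEquiv, ← LinearMap.comp_apply (TensorProduct.map _ _),
    ← TensorProduct.map_comp, hn, hm]

variable (K C) in
theorem swap_smul_iterComul_two [Coalgebra.IsCocomm K C] (x : C) :
    Equiv.swap (0 : Fin 2) 1 • iterComul K C 2 x = iterComul K C 2 x := by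
  let δ : C ⊗[K] C →ₗ[K] ⨂[K]^2 C := TensorPower.mulEquiv.toLinearMap ∘ₗ
    TensorProduct.map (iterComul K C 1) (iterComul K C 1)
  have hδ (y z : C) : δ (y ⊗ₜ z) = PiTensorProduct.tprod K ![y, z] := by
    simp only [δ, LinearMap.comp_apply, TensorProduct.map_tmul, iterComul_one, LinearEquiv.coe_coe,
      PiTensorProduct.subsingletonEquiv_symm_apply', ← tensorMul_apply, tensorMul_tprod]
    exact congrArg _ (funext (Fin.forall_fin_two.2 ⟨rfl, rfl⟩))
  have hcomm : permLin K C (Equiv.swap (0 : Fin 2) 1) ∘ₗ δ =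
      δ ∘ₗ (TensorProduct.comm K C C).toLinearMap := by
    refine TensorProduct.ext' fun y z => ?_
    simp only [LinearMap.comp_apply, LinearEquiv.coe_coe, TensorProduct.comm_tmul, hδ,
      permLin_apply, perm_smul_tprod]
    exact congrArg _ (funext (Fin.forall_fin_two.2 ⟨rfl, rfl⟩))
  have hx : iterComul K C 2 x = δ (Coalgebra.comul x) :=
    LinearMap.congr_fun (iterComul_add K C 1 1) x
  rw [hx]
  refine (LinearMap.congr_fun hcomm (Coalgebra.comul x)).trans ?_
  rw [LinearMap.comp_apply, LinearEquiv.coe_coe, Coalgebra.comm_comul]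

theorem swap_smul_iterComul [Coalgebra.IsCocomm K C] {n : ℕ} {i j : Fin n}
    (hij : j.val = i.val + 1) (x : C) :
    Equiv.swap i j • iterComul K C n x = iterComul K C n x := by
  obtain ⟨l, hl⟩ : ∃ l, i.val = l := ⟨_, rfl⟩
  obtain ⟨k, rfl⟩ : ∃ k, n = l + (2 + k) := ⟨n - (l + 2), by omega⟩
  obtain rfl : i = Fin.natAdd l (Fin.castAdd k 0) := Fin.ext (by simp [hl])
  obtain rfl : j = Fin.natAdd l (Fin.castAdd k 1) := Fin.ext (by simp [hij])
  rw [← permProd_one_swap, ← permProd_swap_one]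
  exact permProd_smul_iterComul (fun _ => one_smul _ _)
    (permProd_smul_iterComul (swap_smul_iterComul_two K C) fun _ => one_smul _ _) x

variable (K C) in
theorem conditionC_range_iterComul [Coalgebra.IsCocomm K C] :
    ConditionC fun n => LinearMap.range (iterComul K C n) := by
  rintro n _ ⟨x, rfl⟩
  refine mem_symTensors.2 fun π => ?_
  cases n with
  | zero => rw [Subsingleton.elim π 1, one_smul]
  | succ n =>
    have hle : (⊤ : Submonoid (Equiv.Perm (Fin (n + 1)))) ≤
        MulAction.stabilizerSubmonoid _ (iterComul K C (n + 1) x) := by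
      rw [← Equiv.Perm.mclosure_swap_castSucc_succ, Submonoid.closure_le]
      rintro _ ⟨i, rfl⟩
      exact swap_smul_iterComul (by simp) x
    exact hle (Submonoid.mem_top π)

end Coalgebra

section Bialgebra

variable (K : Type*) [CommRing K] (A : Type*) [Ring A]

/-- The multiplication `A^{⊗n} ⊗ A^{⊗m} → A^{⊗(n+m)}` of the tensor algebra as a map of algebras. -/
def tensorMulAlgHom [Algebra K A] (n m : ℕ) :
    (⨂[K]^n A) ⊗[K] (⨂[K]^m A) →ₐ[K] ⨂[K]^(n + m) A :=
  Algebra.TensorProduct.lift (insertion (Fin.castAddEmb m)) (insertion (Fin.natAddEmb n))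
    (insertion_commute castAdd_ne_natAdd)

theorem tensorMulAlgHom_toLinearMap [Algebra K A] (n m : ℕ) :
    (tensorMulAlgHom K A n m).toLinearMap = TensorPower.mulEquiv.toLinearMap :=
  TensorProduct.ext' fun x y => (LinearMap.congr_fun₂ (tensorMul_eq_compl₁₂ n m) x y).symm

variable [Bialgebra K A]

theorem exists_algHom_toLinearMap_eq_iterComul (n : ℕ) :
    ∃ f : A →ₐ[K] ⨂[K]^n A, f.toLinearMap = iterComul K A n := by
  induction n with
  | zero =>
    refine ⟨(Algebra.ofId K _).comp (Bialgebra.counitAlgHom K A), LinearMap.ext fun x => ?_⟩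
    refine (Algebra.algebraMap_eq_smul_one (A := ⨂[K]^0 A) (Coalgebra.counit (R := K) x)).trans
      (.trans (congrArg _ ?_) (TensorPower.algebraMap₀_eq_smul_one _).symm)
    exact congrArg (PiTensorProduct.tprod K) (Subsingleton.elim _ _)
  | succ n ih =>
    obtain ⟨f, hf⟩ := ih
    refine ⟨(tensorMulAlgHom K A n 1).comp ((Algebra.TensorProduct.map f
      (PiTensorProduct.singleAlgHom 0)).comp (Bialgebra.comulAlgHom K A)), ?_⟩
    have hsingle :
        (PiTensorProduct.singleAlgHom (R := K) (A := fun _ => A) (0 : Fin 1)).toLinearMap =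
        (PiTensorProduct.subsingletonEquiv (s := fun _ => A) (0 : Fin 1)).symm.toLinearMap := by
      ext x
      simp only [AlgHom.toLinearMap_apply, PiTensorProduct.singleAlgHom_apply, LinearEquiv.coe_coe,
        PiTensorProduct.subsingletonEquiv_symm_apply']
      exact congrArg _ (funext fun i => by
        rw [Subsingleton.elim i 0, MonoidHom.mulSingle_apply, Pi.mulSingle_eq_same])
    rw [AlgHom.comp_toLinearMap, AlgHom.comp_toLinearMap, tensorMulAlgHom_toLinearMap,
      Algebra.TensorProduct.toLinearMap_map, hf, hsingle]
    rfl

theorem conditionB_range_iterComul : ConditionB fun n => LinearMap.range (iterComul K A n) := by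
  rintro n _ ⟨x, rfl⟩ _ ⟨y, rfl⟩
  obtain ⟨f, hf⟩ := exists_algHom_toLinearMap_eq_iterComul K A n
  exact ⟨x * y, by simp only [← hf, AlgHom.toLinearMap_apply, map_mul]⟩

theorem one_mem_range_iterComul (n : ℕ) : 1 ∈ LinearMap.range (iterComul K A n) := by
  obtain ⟨f, hf⟩ := exists_algHom_toLinearMap_eq_iterComul K A n
  exact ⟨1, hf ▸ map_one f⟩

end Bialgebra

end FreeQSym

end

theorem mainTheorem6_general (K : Type*) [CommRing K] :
    (∀ (A : Type*) [Ring A] [Algebra K A]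
      (B : (n : ℕ) → Submodule K (PiTensorProduct K fun _ : Fin n => A)),
      FreeQSym.SplitsInTwo B → FreeQSym.ConditionB B → FreeQSym.ConditionC B →
        FreeQSym.IsInternalSubalgebra (FreeQSym.descentAlgebra B) ∧
          ∀ n : ℕ, 1 ∈ B n → 1 ∈ FreeQSym.component (FreeQSym.descentAlgebra B) n) ∧
    (∀ (A : Type*) [Ring A] [Algebra K A] [Module.Projective K A],
      FreeQSym.IsInternalSubalgebra (FreeQSym.novelliThibon K A) ∧
        ∀ n : ℕ, 1 ∈ FreeQSym.component (FreeQSym.novelliThibon K A) n) ∧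
    (∀ (A : Type*) [Ring A] [Bialgebra K A] [Coalgebra.IsCocomm K A],
      FreeQSym.IsInternalSubalgebra (FreeQSym.mantaciReutenauer K A) ∧
        ∀ n : ℕ, 1 ∈ FreeQSym.component (FreeQSym.mantaciReutenauer K A) n) := by
  refine ⟨fun A _ _ B hA hB hC => ⟨?_, fun n => ?_⟩, fun A _ _ _ => ⟨?_, fun n => ?_⟩,
    fun A _ _ _ => ⟨?_, fun n => ?_⟩⟩
  · exact FreeQSym.isInternalSubalgebra_descentAlgebra hA hB hC
  · exact FreeQSym.single_one_mem_component
  · exact FreeQSym.isInternalSubalgebra_descentAlgebra (FreeQSym.splitsInTwo_symTensors A)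
      (FreeQSym.conditionB_symTensors A) fun _ => le_rfl
  · exact FreeQSym.single_one_mem_component (FreeQSym.one_mem_symTensors A n)
  · exact FreeQSym.isInternalSubalgebra_descentAlgebra (FreeQSym.splitsInTwo_range_iterComul K A)
      (FreeQSym.conditionB_range_iterComul K A) (FreeQSym.conditionC_range_iterComul K A)
  · exact FreeQSym.single_one_mem_component (FreeQSym.one_mem_range_iterComul K A n)

theorem mainTheorem6 (K : Type*) [CommRing K] :
    (∀ (A : Type*) [Ring A] [Algebra K A] [Module.Projective K A]
      (B : (n : ℕ) → Submodule K (PiTensorProduct K fun _ : Fin n => A)),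
      FreeQSym.ConditionA B → FreeQSym.ConditionB B → FreeQSym.ConditionC B →
        FreeQSym.IsInternalSubalgebra (FreeQSym.descentAlgebra B) ∧
          ∀ n : ℕ, 1 ∈ B n → 1 ∈ FreeQSym.component (FreeQSym.descentAlgebra B) n) ∧
    (∀ (A : Type*) [Ring A] [Algebra K A] [Module.Projective K A],
      FreeQSym.IsInternalSubalgebra (FreeQSym.novelliThibon K A) ∧
        ∀ n : ℕ, 1 ∈ FreeQSym.component (FreeQSym.novelliThibon K A) n) ∧
    (∀ (A : Type*) [Ring A] [Bialgebra K A] [Coalgebra.IsCocomm K A] [Module.Projective K A],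
      FreeQSym.IsInternalSubalgebra (FreeQSym.mantaciReutenauer K A) ∧
        ∀ n : ℕ, 1 ∈ FreeQSym.component (FreeQSym.mantaciReutenauer K A) n) := by
  obtain ⟨general, symmetric, cocommutative⟩ := mainTheorem6_general K
  exact ⟨fun A _ _ _ B hA => general A B hA.splitsInTwo, symmetric,
    fun A _ _ _ _ => cocommutative A⟩
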